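/- Let $\mathbb{F}_q$ be a finite field with $q$ elements and characteristic greater than $3$. A (plane) conic over $\mathbb{F}_q$ is a nonzero homogeneous quadratic form in $x,y,z$ with coefficients in $\mathbb{F}_q$, up to multiplication by a nonzero scalar; its points are its zeros in $\mathbb{P}^2(\overline{\mathbb{F}}_q)$. It is smooth if it has no singular point over $\overline{\mathbb{F}}_q$, and two smooth conics intersect transversally if their tangent lines are distinct at every common point over $\overline{\mathbb{F}}_q$. Let $\Psi$ be the set of ordered pairs $(\mathcal{A},\mathcal{B})$ of smooth conics over $\mathbb{F}_q$ that intersect transversally. For $(\mathcal{A},\mathcal{B})\in\Psi$ let $E$ be the set of pairs $(P,\xi)$, defined over $\overline{\mathbb{F}}_q$, of a point $P\in\mathcal{A}$ and a line $\xi$ tangent to $\mathcal{B}$ with $P\in\xi$. Define $j:E\to E$, $j(P,\xi)=(P',\xi')$, where $P'$ is the other intersection point of $\xi$ with $\mathcal{A}$ (with $P'=P$ exactly when $\xi$ is tangent to $\mathcal{A}$ at $P$), and $\xi'$ is the other tangent line to $\mathcal{B}$ through $P'$ (with $\xi'=\xi$ exactly when $P'\in\mathcal{B}$). The pair $(\mathcal{A},\mathcal{B})$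 satisfies the Poncelet triangle condition if $j^3(P,\xi)=(P,\xi)$ for some $(P,\xi)\in E$. Let $\Gamma_3\subseteq\Psi$ be the set of pairs satisfying this condition. Then $$|\Gamma_3| = (q^5-q^2)(q+1)\,q\,(q-1)^2,$$ and therefore $$\frac{|\Gamma_3|}{|\Psi|}=\frac{q-1}{q^2-q+1}.$$ -/

import Mathlib

open scoped LinearAlgebra.Projectivization

noncomputable section

namespace Poncelet

/-- A plane conic over `K`: a nonzero homogeneous polynomial of degree `2` in three variables
with coefficients in `K`, up to multiplication by a nonzero scalar of `K`. -/
abbrev Conic (K : Type*) [Field K] : Type _ :=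
  ℙ K (MvPolynomial.homogeneousSubmodule (Fin 3) K 2)

/-- The points of the projective plane over the algebraic closure of `K`. -/
abbrev Point (K : Type*) [Field K] : Type _ :=
  ℙ (AlgebraicClosure K) (Fin 3 → AlgebraicClosure K)

/-- The lines of the projective plane over the algebraic closure of `K`, as points of the dual
plane: `[a : b : c]` is the line `a x + b y + c z = 0`. -/
abbrev Line (K : Type*) [Field K] : Type _ :=
  ℙ (AlgebraicClosure K) (Fin 3 → AlgebraicClosure K)

variable {K : Type*} [Field K]

/-- The point `P` lies on the line `ξ`. -/
def Incident (P : Point K) (ξ : Line K) : Prop :=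
  Projectivization.orthogonal P ξ

/-- A quadratic form that defines the conic `C`; it is determined up to a nonzero scalar, and
nothing below depends on the choice. -/
def Conic.form (C : Conic K) : MvPolynomial (Fin 3) K :=
  (C.rep : MvPolynomial (Fin 3) K)

/-- The geometric point `P` lies on the conic `C`. -/
def OnConic (P : Point K) (C : Conic K) : Prop :=
  MvPolynomial.aeval P.rep C.form = 0

/-- The gradient of the form of `C` at `P`; up to a nonzero scalar it is independent of the
representatives that are chosen for `C` and `P`. -/
def gradient (C : Conic K) (P : Point K) : Fin 3 → AlgebraicClosure K :=
  fun i => MvPolynomial.aeval P.rep (MvPolynomial.pderiv i C.form)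

/-- `C` is smooth: it has no singular point over the algebraic closure. -/
def IsSmooth (C : Conic K) : Prop :=
  ∀ P : Point K, OnConic P C → gradient C P ≠ 0

/-- `A` and `B` intersect transversally: at each common point over the algebraic closure both
are nonsingular and their tangent lines are distinct. -/
def IsTransversal (A B : Conic K) : Prop :=
  ∀ P : Point K, OnConic P A → OnConic P B →
    LinearIndependent (AlgebraicClosure K) ![gradient A P, gradient B P]

/-- `ξ` is the tangent line of `C` at the (nonsingular) point `P` of `C`. -/
def IsTangentAt (C : Conic K) (P : Point K) (ξ : Line K) : Prop :=
  OnConic P C ∧ ∃ c : AlgebraicClosure K, c ≠ 0 ∧ gradient C P = c • ξ.rep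

/-- The dual conic: the set of all tangent lines of `C`. -/
def dualConic (C : Conic K) : Set (Line K) :=
  {ξ | ∃ Q : Point K, IsTangentAt C Q ξ}

/-- The pairs `(P, ξ)` of a point `P` of `A` and a tangent line `ξ` of `B` through `P`. -/
def incidenceCurve (A B : Conic K) : Set (Point K × Line K) :=
  {e | OnConic e.1 A ∧ e.2 ∈ dualConic B ∧ Incident e.1 e.2}

/-- The graph of the Poncelet map `j : (P, ξ) ↦ (P', ξ')`: the point `P'` is the other
intersection point of `ξ` with `A`, and `ξ'` is the other tangent line to `B` through `P'`.
Multiplicities are counted: `P' = P` exactly if `ξ` touches `A` at `P`, and `ξ' = ξ` exactly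
if `P'` lies on `B`. -/
def PonceletStep (A B : Conic K) (e e' : Point K × Line K) : Prop :=
  e ∈ incidenceCurve A B ∧ e' ∈ incidenceCurve A B ∧
    Incident e'.1 e.2 ∧ (e'.1 = e.1 ↔ IsTangentAt A e.1 e.2) ∧
    (e'.2 = e.2 ↔ OnConic e'.1 B)

/-- The Poncelet triangle condition: `j (j (j e)) = e` for some initial datum `e`. -/
def PonceletTriangle (A B : Conic K) : Prop :=
  ∃ e₀ e₁ e₂ : Point K × Line K,
    PonceletStep A B e₀ e₁ ∧ PonceletStep A B e₁ e₂ ∧ PonceletStep A B e₂ e₀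

/-- The ordered pairs of smooth conics over `K` with transversal intersection. -/
def Psi (K : Type*) [Field K] : Set (Conic K × Conic K) :=
  {p | IsSmooth p.1 ∧ IsSmooth p.2 ∧ IsTransversal p.1 p.2}

/-- The pairs in `Psi K` that satisfy the Poncelet triangle condition. -/
def Gamma3 (K : Type*) [Field K] : Set (Conic K × Conic K) :=
  {p | p ∈ Psi K ∧ PonceletTriangle p.1 p.2}

end Poncelet

end

/-! Conics become symmetric 3×3 matrices A, B (their Hessians), up to scalars. Everything is read
off from the characteristic data (τ, σ, δ) of A⁻¹B, that is, from the pencil det(tA + B) / det A =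
t³ + τt² + σt + δ. For smooth A, smoothness of B means δ ≠ 0. Transversality means nonzero
discriminant, because a common point with a common tangent corresponds to a repeated root
(`isTransversal_iff`). The triangle condition becomes Cayley's criterion σ² = 4δτ.

Cayley's criterion is proved without the group law on E. A closed orbit with distinct vertices
yields the equation by computing Gram matrices in the basis of vertices (`sq_eq_of_triangle`). All
other closed orbits, and the converse, reduce to one degenerate configuration: a common point q of
the conics, the second point p of A on the tangent to B at q, and the contact point r of the other
tangent from p to B. There σ² − 4δτ vanishes exactly when the line pr touches A
(`sq_eq_iff_of_degenerate`), and then the orbit through p closes after three steps.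

For the count, fix (τ, σ, δ) with nonzero discriminant. The matrices M = A⁻¹B with these data form
one conjugacy class of GL₃, and for given M the admissible A form a coset of the invertible part of
the centralizer of M. Hence every admissible cubic accounts for |GL₃| pairs (A, B)
(`card_selfAdjoint`). There are (q − 1)(q² − q + 1) cubics for Ψ and (q − 1)² for Γ₃; division by
the (q − 1)² scalars gives both claims, with |Γ₃| = |GL₃(q)|. -/

noncomputable section

namespace Poncelet

/-! ### Cubic polynomials `t³ - τ t² + σ t - δ` -/

/-- The discriminant of `t³ - τ t² + σ t - δ`. -/
def cubicDiscr {F : Type*} [CommRing F] (x : F × F × F) : F :=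
  x.1 ^ 2 * x.2.1 ^ 2 - 4 * x.2.1 ^ 3 - 4 * x.1 ^ 3 * x.2.2 - 27 * x.2.2 ^ 2
    + 18 * x.1 * x.2.1 * x.2.2

/-- The elementary symmetric functions of `r, r, s`. -/
def doubleRoot {F : Type*} [CommRing F] (r s : F) : F × F × F :=
  (2 * r + s, r ^ 2 + 2 * r * s, r ^ 2 * s)

lemma cubicDiscr_doubleRoot {F : Type*} [CommRing F] (r s : F) :
    cubicDiscr (doubleRoot r s) = 0 := by
  simp only [cubicDiscr, doubleRoot]; ring

/-- A repeated root is rational in the coefficients, so F need not be closed: roots r, r, s give τ²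
− 3σ = (r − s)² and τσ − 9δ = 2r(r − s)². If τ² = 3σ, the root is triple. -/
lemma cubicDiscr_eq_zero_iff {F : Type*} [Field F] (h2 : (2 : F) ≠ 0) (h3 : (3 : F) ≠ 0)
    (x : F × F × F) : cubicDiscr x = 0 ↔ ∃ r s, x = doubleRoot r s := by
  refine ⟨fun h => ?_, fun ⟨r, s, h⟩ => h ▸ cubicDiscr_doubleRoot r s⟩
  obtain ⟨τ, σ, δ⟩ := x
  simp only [cubicDiscr] at h
  by_cases h0 : τ ^ 2 - 3 * σ = 0
  · have hσ : σ = τ ^ 2 / 3 := by field_simp; linear_combination -h0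
    have hδ : δ = τ ^ 3 / 27 := by
      have h27 : (27 : F) ≠ 0 := by
        have := pow_ne_zero 3 h3
        norm_num at this
        exact this
      have : 27 * (δ - τ ^ 3 / 27) ^ 2 = 0 := by
        rw [hσ] at h
        have h' := h
        field_simp at h' ⊢
        linear_combination -h'
      have := (mul_eq_zero.mp this).resolve_left h27
      exact sub_eq_zero.mp (pow_eq_zero_iff (two_ne_zero) |>.mp this)
    have h27 : (27 : F) = 3 ^ 3 := by norm_num
    refine ⟨τ / 3, τ / 3, ?_⟩
    simp only [doubleRoot, Prod.mk.injEq]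
    refine ⟨?_, ?_, ?_⟩
    · field_simp; ring
    · rw [hσ]; field_simp; ring
    · rw [hδ, h27]; field_simp
  · obtain ⟨r, hr⟩ : ∃ r, 2 * (τ ^ 2 - 3 * σ) * r = τ * σ - 9 * δ :=
      ⟨(τ * σ - 9 * δ) / (2 * (τ ^ 2 - 3 * σ)), mul_div_cancel₀ _ (mul_ne_zero h2 h0)⟩
    have h4 : (4 : F) = 2 ^ 2 := by norm_num
    refine ⟨r, τ - 2 * r, ?_⟩
    simp only [doubleRoot, Prod.mk.injEq]
    refine ⟨by ring, ?_, ?_⟩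
    · have : 4 * (τ ^ 2 - 3 * σ) ^ 2 ≠ 0 := by rw [h4]; positivity
      refine mul_left_cancel₀ this ?_
      linear_combination (-9) * h + (3 * (2 * (τ ^ 2 - 3 * σ) * r + τ * σ - 9 * δ)
        - 4 * τ * (τ ^ 2 - 3 * σ)) * hr
    · have : 4 * (τ ^ 2 - 3 * σ) ^ 3 ≠ 0 := by rw [h4]; positivity
      refine mul_left_cancel₀ this ?_
      linear_combination (27 * δ - τ ^ 3) * h + ((2 * (τ ^ 2 - 3 * σ) * r) ^ 2
        + 2 * (τ ^ 2 - 3 * σ) * r * (τ * σ - 9 * δ) + (τ * σ - 9 * δ) ^ 2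
        - τ * (τ ^ 2 - 3 * σ) * (2 * (τ ^ 2 - 3 * σ) * r + τ * σ - 9 * δ)) * hr

lemma doubleRoot_injective {F : Type*} [Field F] {r s r' s' : F}
    (h : doubleRoot r s = doubleRoot r' s') : r = r' ∧ s = s' := by
  simp only [doubleRoot, Prod.mk.injEq] at h
  obtain ⟨h1, h2, h3⟩ := h
  have hr : r = r' := by
    by_contra hne
    have hd : r - r' ≠ 0 := sub_ne_zero.mpr hne
    have hs : s' = s + 2 * r - 2 * r' := by linear_combination -h1
    subst hs
    have e1 : (r - r') * (2 * (2 * r + s) - 3 * (r + r')) = 0 := by linear_combination h2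
    have e2 : (r - r') * ((2 * r + s) * (r + r') - 2 * (r ^ 2 + r * r' + r' ^ 2)) = 0 := by
      linear_combination h3
    have f1 := (mul_eq_zero.mp e1).resolve_left hd
    have f2 := (mul_eq_zero.mp e2).resolve_left hd
    have : (r - r') ^ 2 = 0 := by linear_combination (r + r') * f1 - 2 * f2
    exact hd (pow_eq_zero_iff two_ne_zero |>.mp this)
  subst hr
  exact ⟨rfl, by linear_combination h1⟩

/-! ### Counting cubics over a finite field -/

section Count

variable (K : Type*) [Field K] [Fintype K]

open Finset in
open scoped Classical in
/-- Monic cubics with nonzero constant term and nonzero discriminant. -/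
lemma card_discr_ne_zero (h2 : (2 : K) ≠ 0) (h3 : (3 : K) ≠ 0) :
    #{x : K × K × K | x.2.2 ≠ 0 ∧ cubicDiscr x ≠ 0} + (Fintype.card K - 1) ^ 2 =
      Fintype.card K ^ 2 * (Fintype.card K - 1) := by
  have hbad : #{x : K × K × K | x.2.2 ≠ 0 ∧ ¬ cubicDiscr x ≠ 0} = (Fintype.card K - 1) ^ 2 := by
    rw [← Fintype.card_units, sq, ← Fintype.card_prod, ← card_univ]
    symm
    refine card_bij (fun p _ => doubleRoot (p.1 : K) (p.2 : K)) ?_ ?_ ?_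
    · intro p _
      simp only [mem_filter, mem_univ, true_and, not_not, cubicDiscr_doubleRoot, and_true]
      simp [doubleRoot]
    · rintro ⟨r, s⟩ _ ⟨r', s'⟩ _ h
      obtain ⟨h1, h2⟩ := doubleRoot_injective h
      exact Prod.ext (Units.ext h1) (Units.ext h2)
    · rintro x hx
      simp only [mem_filter, mem_univ, true_and, not_not] at hx
      obtain ⟨r, s, rfl⟩ := (cubicDiscr_eq_zero_iff h2 h3 x).mp hx.2
      have : r ≠ 0 ∧ s ≠ 0 := by simpa [doubleRoot] using hx.1
      exact ⟨(Units.mk0 r this.1, Units.mk0 s this.2), mem_univ _, rfl⟩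
  have hall : #{x : K × K × K | x.2.2 ≠ 0} = Fintype.card K ^ 2 * (Fintype.card K - 1) := by
    have : ({x : K × K × K | x.2.2 ≠ 0} : Finset _) =
        (univ : Finset K) ×ˢ ((univ : Finset K) ×ˢ ({0}ᶜ : Finset K)) := by
      ext x; simp
    rw [this, card_product, card_product, card_compl, card_univ, card_singleton]; ring
  rw [← hbad, ← hall, ← filter_filter, ← filter_filter, card_filter_add_card_filter_not]

open Finset in
open scoped Classical in
-- On the surface σ² = 4δτ, the values σ and δ ≠ 0 determine τ, which gives q(q − 1) points. Nonzero
-- roots r, r, s lie on it exactly when r = 4s, which removes q − 1 of them.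
lemma card_discr_ne_zero_of_sq_eq (h2 : (2 : K) ≠ 0) (h3 : (3 : K) ≠ 0) :
    #{x : K × K × K | (x.2.2 ≠ 0 ∧ cubicDiscr x ≠ 0) ∧ x.2.1 ^ 2 = 4 * x.2.2 * x.1} =
      (Fintype.card K - 1) ^ 2 := by
  have h4 : (4 : K) ≠ 0 := by
    have := pow_ne_zero 2 h2
    norm_num at this
    exact this
  have hbad : #{x : K × K × K | (x.2.2 ≠ 0 ∧ x.2.1 ^ 2 = 4 * x.2.2 * x.1) ∧ ¬ cubicDiscr x ≠ 0} =
      Fintype.card K - 1 := by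
    rw [← Fintype.card_units, ← card_univ]
    symm
    refine card_bij (fun s _ => doubleRoot (4 * s : K) (s : K)) ?_ ?_ ?_
    · intro s _
      simp only [mem_filter, mem_univ, true_and, not_not, cubicDiscr_doubleRoot, and_true]
      refine ⟨by simp [doubleRoot, h4], by simp only [doubleRoot]; ring⟩
    · intro r _ s _ h
      exact Units.ext (doubleRoot_injective h).2
    · rintro x hx
      simp only [mem_filter, mem_univ, true_and, not_not] at hx
      obtain ⟨r, s, rfl⟩ := (cubicDiscr_eq_zero_iff h2 h3 x).mp hx.2
      have h0 : r ≠ 0 ∧ s ≠ 0 := by simpa [doubleRoot] using hx.1.1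
      have h1 := hx.1.2
      simp only [doubleRoot] at h1
      have : r ^ 3 * (r - 4 * s) = 0 := by linear_combination h1
      have hr := sub_eq_zero.mp ((mul_eq_zero.mp this).resolve_left (pow_ne_zero 3 h0.1))
      exact ⟨Units.mk0 s h0.2, mem_univ _, by simp [hr]⟩
  have hall : #{x : K × K × K | x.2.2 ≠ 0 ∧ x.2.1 ^ 2 = 4 * x.2.2 * x.1} =
      Fintype.card K * (Fintype.card K - 1) := by
    rw [← Fintype.card_units, ← Fintype.card_prod, ← card_univ]
    symm
    refine card_bij (fun p _ => (p.1 ^ 2 / (4 * (p.2 : K)), p.1, (p.2 : K))) ?_ ?_ ?_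
    · intro p _
      have := p.2.ne_zero
      simp only [mem_filter, mem_univ, true_and]
      exact ⟨this, by field_simp⟩
    · rintro ⟨a, b⟩ _ ⟨c, d⟩ _ h
      simp only [Prod.mk.injEq] at h
      exact Prod.ext h.2.1 (Units.ext h.2.2)
    · rintro ⟨x, y, z⟩ h
      simp only [mem_filter, mem_univ, true_and] at h
      have hz := h.1
      refine ⟨(y, Units.mk0 z hz), mem_univ _, ?_⟩
      simp only [Units.val_mk0, Prod.mk.injEq, and_true]
      rw [h.2]; field_simp
  have key := card_filter_add_card_filter_not (s := ({x : K × K × K | x.2.2 ≠ 0 ∧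
    x.2.1 ^ 2 = 4 * x.2.2 * x.1} : Finset _)) (fun x => cubicDiscr x ≠ 0)
  rw [filter_filter, filter_filter, hbad, hall] at key
  have e : ({x : K × K × K | (x.2.2 ≠ 0 ∧ cubicDiscr x ≠ 0) ∧ x.2.1 ^ 2 = 4 * x.2.2 * x.1} :
      Finset (K × K × K)) = ({x : K × K × K | (x.2.2 ≠ 0 ∧ x.2.1 ^ 2 = 4 * x.2.2 * x.1) ∧
        cubicDiscr x ≠ 0} : Finset (K × K × K)) := by
    ext x; simp only [mem_filter, mem_univ, true_and]; tauto
  rw [e]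
  obtain ⟨n, hn⟩ : ∃ n, Fintype.card K = n + 1 :=
    ⟨Fintype.card K - 1, (Nat.succ_pred_eq_of_pos Fintype.card_pos).symm⟩
  rw [hn] at key ⊢
  simp only [Nat.add_sub_cancel] at key ⊢
  nlinarith

end Count

open Matrix

/-! ### Characteristic data and cyclic vectors of `3 × 3` matrices -/

/-- The coefficients `(τ, σ, δ)` of the characteristic polynomial `t³ - τ t² + σ t - δ`. -/
def charData {F : Type*} [CommRing F] (M : Matrix (Fin 3) (Fin 3) F) : F × F × F :=
  (M.trace, M.adjugate.trace, M.det)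

/-- The companion matrix of `t³ - τ t² + σ t - δ`. -/
def companion {F : Type*} [CommRing F] (x : F × F × F) : Matrix (Fin 3) (Fin 3) F :=
  !![0, 0, x.2.2; 1, 0, -x.2.1; 0, 1, x.1]

lemma charData_companion {F : Type*} [CommRing F] (x : F × F × F) :
    charData (companion x) = x := by
  obtain ⟨a, b, c⟩ := x
  simp [charData, companion, trace_fin_three, adjugate_fin_three, det_fin_three]

lemma charData_eq_of_mul_eq {F : Type*} [Field F] {M N : Matrix (Fin 3) (Fin 3) F}
    {g : GL (Fin 3) F} (h : M * g.val = g.val * N) : charData M = charData N := by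
  have hM : M = g.val * N * (g⁻¹).val := by
    rw [← h, Matrix.mul_assoc]; simp
  have hg : (g⁻¹).val * g.val = 1 := by simp
  have hg' : adjugate g.val * adjugate (g⁻¹).val = 1 := by
    rw [← adjugate_mul_distrib, hg, adjugate_one]
  rw [hM]
  simp only [charData, Prod.mk.injEq]
  refine ⟨?_, ?_, ?_⟩
  · rw [trace_mul_comm, ← Matrix.mul_assoc, hg, Matrix.one_mul]
  · rw [adjugate_mul_distrib, adjugate_mul_distrib, ← Matrix.mul_assoc, trace_mul_comm,
      ← Matrix.mul_assoc, hg', Matrix.one_mul]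
  · rw [det_mul, det_mul, mul_right_comm, ← det_mul, ← Matrix.det_mul]
    simp

lemma pow_three_eq {F : Type*} [CommRing F] (M : Matrix (Fin 3) (Fin 3) F) :
    M * (M * M) = (charData M).1 • (M * M) - (charData M).2.1 • M
      + (charData M).2.2 • (1 : Matrix (Fin 3) (Fin 3) F) := by
  ext i j
  fin_cases i <;> fin_cases j <;>
  simp [charData, trace_fin_three, adjugate_fin_three, det_fin_three, mul_apply,
    Fin.sum_univ_three] <;> ring

lemma det_smul_one_sub {F : Type*} [CommRing F] (M : Matrix (Fin 3) (Fin 3) F) (t : F) :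
    (M - t • (1 : Matrix (Fin 3) (Fin 3) F)).det =
      -(t ^ 3 - (charData M).1 * t ^ 2 + (charData M).2.1 * t - (charData M).2.2) := by
  simp [charData, trace_fin_three, adjugate_fin_three, det_fin_three]
  ring

/-- The matrix with rows `v`, `M v`, `M² v`. -/
def krylov {F : Type*} [CommRing F] (M : Matrix (Fin 3) (Fin 3) F) (v : Fin 3 → F) :
    Matrix (Fin 3) (Fin 3) F :=
  of ![v, M *ᵥ v, M *ᵥ (M *ᵥ v)]

/-- In the basis v, Mv, M²v the matrix M becomes the companion matrix; the last column is
Cayley–Hamilton. -/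
lemma exists_mul_eq_mul_companion {F : Type*} [Field F] {M : Matrix (Fin 3) (Fin 3) F}
    {v : Fin 3 → F} (hv : (krylov M v).det ≠ 0) :
    ∃ g : GL (Fin 3) F, M * g.val = g.val * companion (charData M) := by
  have hd : (krylov M v)ᵀ.det ≠ 0 := by rwa [det_transpose]
  refine ⟨GeneralLinearGroup.mkOfDetNeZero _ hd, ?_⟩
  have h3 : M *ᵥ (M *ᵥ (M *ᵥ v)) = (charData M).1 • (M *ᵥ (M *ᵥ v)) -
      (charData M).2.1 • (M *ᵥ v) + (charData M).2.2 • v := by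
    have := congrArg (· *ᵥ v) (pow_three_eq M)
    simpa [add_mulVec, sub_mulVec, smul_mulVec, ← mulVec_mulVec] using this
  change M * (krylov M v)ᵀ = (krylov M v)ᵀ * _
  ext i j
  have e3 := congrFun h3 i
  fin_cases j
  · simp [companion, krylov, mul_apply, Fin.sum_univ_three, mulVec, dotProduct]
  · simp [companion, krylov, mul_apply, Fin.sum_univ_three, mulVec, dotProduct, -mulVec_mulVec]
  · simp only [mul_apply, Fin.sum_univ_three]
    simp only [mulVec, dotProduct, Fin.sum_univ_three] at e3
    simp [companion, krylov, mulVec, dotProduct, Fin.sum_univ_three, -mulVec_mulVec] at e3 ⊢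
    linear_combination e3

lemma exists_roots {F : Type*} [Field F] [IsAlgClosed F] (h2 : (2 : F) ≠ 0)
    (M : Matrix (Fin 3) (Fin 3) F) :
    ∃ r : Fin 3 → F, charData M =
      (r 0 + r 1 + r 2, r 0 * r 1 + r 0 * r 2 + r 1 * r 2, r 0 * r 1 * r 2) := by
  obtain ⟨r, hr⟩ := Module.End.exists_eigenvalue (Matrix.toLin' M)
  obtain ⟨v, hv⟩ := hr.exists_hasEigenvector
  have hMv : (M - r • (1 : Matrix (Fin 3) (Fin 3) F)) *ᵥ v = 0 := by
    have := hv.apply_eq_smul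
    rw [toLin'_apply] at this
    rw [sub_mulVec, this, smul_mulVec, one_mulVec, sub_self]
  have hdet := exists_mulVec_eq_zero_iff.mp ⟨v, hv.2, hMv⟩
  rw [det_smul_one_sub] at hdet
  generalize charData M = x at hdet ⊢
  obtain ⟨τ, σ, δ⟩ := x
  -- z is a square root of the discriminant of the quadratic left after dividing by t − r.
  obtain ⟨z, hz⟩ := IsAlgClosed.exists_pow_nat_eq
    ((τ - r) ^ 2 - 4 * (σ - r * (τ - r))) (n := 2) two_pos
  refine ⟨![r, (τ - r + z) / 2, (τ - r - z) / 2], ?_⟩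
  have hp : (τ - r + z) / 2 * ((τ - r - z) / 2) = σ - r * (τ - r) := by
    rw [div_mul_div_comm, div_eq_iff (mul_ne_zero h2 h2)]
    linear_combination -hz
  have hs : (τ - r + z) / 2 + (τ - r - z) / 2 = τ - r := by field_simp; ring
  simp only [Prod.mk.injEq, cons_val_zero, cons_val_one, cons_val]
  refine ⟨by linear_combination -hs, by linear_combination -hp - r * hs, ?_⟩
  linear_combination hdet - r * hp

lemma cubicDiscr_roots {F : Type*} [CommRing F] (r : Fin 3 → F) :
    cubicDiscr (r 0 + r 1 + r 2, r 0 * r 1 + r 0 * r 2 + r 1 * r 2, r 0 * r 1 * r 2) =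
      ((r 0 - r 1) * (r 0 - r 2) * (r 1 - r 2)) ^ 2 := by
  simp only [cubicDiscr]; ring

lemma exists_krylov_of_isAlgClosed {F : Type*} [Field F] [IsAlgClosed F] (h2 : (2 : F) ≠ 0)
    {M : Matrix (Fin 3) (Fin 3) F} (hM : cubicDiscr (charData M) ≠ 0) :
    ∃ v, (krylov M v).det ≠ 0 := by
  obtain ⟨r, hr⟩ := exists_roots h2 M
  have hd : (r 0 - r 1) * (r 0 - r 2) * (r 1 - r 2) ≠ 0 := by
    rw [hr, cubicDiscr_roots] at hM
    exact (pow_ne_zero_iff two_ne_zero).mp hM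
  have hev : ∀ i, ∃ v : Fin 3 → F, v ≠ 0 ∧ M *ᵥ v = r i • v := by
    intro i
    have : (M - r i • (1 : Matrix (Fin 3) (Fin 3) F)).det = 0 := by
      rw [det_smul_one_sub, hr]
      fin_cases i <;> simp <;> ring
    obtain ⟨v, hv, h⟩ := exists_mulVec_eq_zero_iff.mpr this
    refine ⟨v, hv, ?_⟩
    rw [sub_mulVec, smul_mulVec, one_mulVec] at h
    exact sub_eq_zero.mp h
  choose v hv0 hv using hev
  have hinj : Function.Injective r := by
    have h01 : r 0 ≠ r 1 := fun h => hd (by rw [h]; ring)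
    have h02 : r 0 ≠ r 2 := fun h => hd (by rw [h]; ring)
    have h12 : r 1 ≠ r 2 := fun h => hd (by rw [h]; ring)
    intro i j h
    fin_cases i <;> fin_cases j <;> simp_all
  have hli : LinearIndependent F v :=
    Module.End.eigenvectors_linearIndependent' (Matrix.toLin' M) r hinj v
      (fun i => ⟨Module.End.mem_eigenspace_iff.mpr (by rw [toLin'_apply, hv]), hv0 i⟩)
  have hdet : (of v).det ≠ 0 :=
    ((of v).isUnit_iff_isUnit_det.mp (linearIndependent_rows_iff_isUnit.mp hli)).ne_zero
  refine ⟨v 0 + v 1 + v 2, ?_⟩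
  -- M scales each eigenvector by its root, so the Krylov matrix of their sum is a Vandermonde
  -- matrix times the matrix of eigenvectors.
  have hk : krylov M (v 0 + v 1 + v 2) =
      !![1, 1, 1; r 0, r 1, r 2; r 0 ^ 2, r 1 ^ 2, r 2 ^ 2] * of v := by
    ext i j
    fin_cases i <;>
      simp [krylov, mulVec_add, hv, mulVec_smul, mul_apply, Fin.sum_univ_three] <;> ring
  rw [hk, det_mul]
  refine mul_ne_zero ?_ hdet
  have : det !![1, 1, 1; r 0, r 1, r 2; r 0 ^ 2, r 1 ^ 2, r 2 ^ 2] =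
      -((r 0 - r 1) * (r 0 - r 2) * (r 1 - r 2)) := by
    simp [det_fin_three]; ring
  rw [this]
  exact neg_ne_zero.mpr hd

lemma charData_map {F L : Type*} [CommRing F] [CommRing L] (φ : F →+* L)
    (M : Matrix (Fin 3) (Fin 3) F) :
    charData (M.map φ) = ((φ (charData M).1, φ (charData M).2.1, φ (charData M).2.2)) := by
  simp [charData, trace_fin_three, adjugate_fin_three, det_fin_three]

lemma cubicDiscr_map {F L : Type*} [CommRing F] [CommRing L] (φ : F →+* L) (x : F × F × F) :
    cubicDiscr (φ x.1, φ x.2.1, φ x.2.2) = φ (cubicDiscr x) := by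
  simp only [cubicDiscr, map_add, map_sub, map_mul, map_pow, map_ofNat]

lemma krylov_map {F L : Type*} [CommRing F] [CommRing L] (φ : F →+* L)
    (M : Matrix (Fin 3) (Fin 3) F) (v : Fin 3 → F) :
    krylov (M.map φ) (φ ∘ v) = (krylov M v).map φ := by
  ext i j
  fin_cases i <;> simp [krylov, mulVec, dotProduct, Fin.sum_univ_three, -mulVec_mulVec]

/-- Over a finite field with more than three elements, a matrix whose characteristic polynomial
has nonzero discriminant has a cyclic vector. -/
lemma exists_krylov {K : Type*} [Field K] [Fintype K] (h2 : (2 : K) ≠ 0)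
    (hcard : 3 < Fintype.card K)
    {M : Matrix (Fin 3) (Fin 3) K} (hM : cubicDiscr (charData M) ≠ 0) :
    ∃ v, (krylov M v).det ≠ 0 := by
  by_contra! hall
  let L := AlgebraicClosure K
  -- The Krylov determinant is a cubic form in v. Its degree in each variable is below |K|, so
  -- vanishing on all of K³ would make it the zero polynomial, against the existence of a cyclic
  -- vector over the closure.
  let P : MvPolynomial (Fin 3) K := (krylov (M.map MvPolynomial.C) MvPolynomial.X).det
  have hP : P.IsHomogeneous 3 := by
    have h1 : ∀ (N : Matrix (Fin 3) (Fin 3) K) (w : Fin 3 → MvPolynomial (Fin 3) K),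
        (∀ i, (w i).IsHomogeneous 1) → ∀ i, ((N.map MvPolynomial.C *ᵥ w) i).IsHomogeneous 1 := by
      intro N w hw i
      refine MvPolynomial.IsHomogeneous.sum _ _ _ (fun j _ => ?_)
      simpa using (MvPolynomial.isHomogeneous_C (Fin 3) (N i j)).mul (hw j)
    have hX : ∀ i, (MvPolynomial.X i : MvPolynomial (Fin 3) K).IsHomogeneous 1 :=
      fun i => MvPolynomial.isHomogeneous_X K i
    have hent : ∀ i j, (krylov (M.map MvPolynomial.C)
        (MvPolynomial.X : Fin 3 → MvPolynomial (Fin 3) K) i j).IsHomogeneous 1 := by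
      intro i j
      fin_cases i
      · exact hX j
      · exact h1 M _ hX j
      · exact h1 M _ (h1 M _ hX) j
    simp only [P, det_apply']
    refine MvPolynomial.IsHomogeneous.sum _ _ _ (fun s _ => ?_)
    have hs := MvPolynomial.IsHomogeneous.prod Finset.univ
      (fun i => krylov (M.map MvPolynomial.C) (MvPolynomial.X : Fin 3 → MvPolynomial (Fin 3) K)
        (s i) i) (fun _ => 1) (fun i _ => hent (s i) i)
    have hc := (MvPolynomial.isHomogeneous_C (Fin 3) (((Equiv.Perm.sign s : ℤ) : K))).mul hs
    simpa using hc
  have hP0 : P = 0 := by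
    refine MvPolynomial.eq_zero_of_eval_zero_at_prod_finset P (fun _ => Finset.univ) ?_ ?_
    · intro i
      calc P.degreeOf i ≤ P.totalDegree := MvPolynomial.degreeOf_le_totalDegree P i
        _ ≤ 3 := hP.totalDegree_le
        _ < _ := by simpa using hcard
    · intro x _
      have := hall x
      simp only [P]
      rw [RingHom.map_det]
      convert this using 2
      rw [RingHom.mapMatrix_apply, ← krylov_map]
      congr 1
      · ext i j; simp
      · ext i; simp
  obtain ⟨v, hv⟩ := exists_krylov_of_isAlgClosed (F := L) (M := M.map (algebraMap K L))
    (by rw [← map_ofNat (algebraMap K L)]; exact (map_ne_zero (algebraMap K L)).mpr h2)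
    (by rw [charData_map, cubicDiscr_map]; exact (map_ne_zero (algebraMap K L)).mpr hM)
  apply hv
  have := congrArg (MvPolynomial.eval₂Hom (algebraMap K L) v) hP0
  simp only [P, RingHom.map_det, RingHom.mapMatrix_apply, ← krylov_map, map_zero] at this
  have e1 : (M.map MvPolynomial.C).map (MvPolynomial.eval₂Hom (algebraMap K L) v) =
      M.map (algebraMap K L) := by
    ext i j; simp
  have e2 : (MvPolynomial.eval₂Hom (algebraMap K L) v) ∘ MvPolynomial.X = v := by
    ext i; simp
  rwa [e1, e2] at this

/-! ### Pairs of a symmetric matrix and a self-adjoint matrix with given characteristic data -/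

/-- The companion matrix shifts the first two basis vectors, so the relation forces N to be a Hankel
matrix. -/
lemma transpose_eq_of_mul_companion {F : Type*} [CommRing F] {x : F × F × F}
    {N : Matrix (Fin 3) (Fin 3) F} (h : N * companion x = (companion x)ᵀ * N) : Nᵀ = N := by
  have e : ∀ i j, (N * companion x) i j = ((companion x)ᵀ * N) i j := fun i j => by rw [h]
  have h00 := e 0 0
  have h01 := e 0 1
  have h10 := e 1 0
  have h11 := e 1 1
  simp [companion, mul_apply, Fin.sum_univ_three] at h00 h01 h10 h11
  ext i j
  fin_cases i <;> fin_cases j <;> simp [*]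

lemma exists_symmetrizer {F : Type*} [Field F] {M : Matrix (Fin 3) (Fin 3) F}
    {g : GL (Fin 3) F} (hg : M * g.val = g.val * companion (charData M)) :
    ∃ S : GL (Fin 3) F, S.val * M = Mᵀ * S.val ∧
      ∀ N : Matrix (Fin 3) (Fin 3) F, N * M = Mᵀ * N → Nᵀ = N := by
  set x := charData M
  have hsym : ∀ N : Matrix (Fin 3) (Fin 3) F, N * M = Mᵀ * N → Nᵀ = N := by
    intro N hN
    have h1 : (g.valᵀ * N * g.val)ᵀ = g.valᵀ * N * g.val := by
      apply transpose_eq_of_mul_companion (x := x)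
      calc g.valᵀ * N * g.val * companion x = g.valᵀ * (N * M) * g.val := by
            rw [Matrix.mul_assoc, ← hg]; simp only [Matrix.mul_assoc]
        _ = (M * g.val)ᵀ * N * g.val := by
            rw [hN, transpose_mul]; simp only [Matrix.mul_assoc]
        _ = _ := by rw [hg, transpose_mul]; simp only [Matrix.mul_assoc]
    have hu : g.val * (g⁻¹).val = 1 := by simp
    have hut : (g⁻¹).valᵀ * g.valᵀ = 1 := by rw [← transpose_mul, hu, transpose_one]
    have h2 : ∀ Y : Matrix (Fin 3) (Fin 3) F,
        (g⁻¹).valᵀ * (g.valᵀ * Y * g.val) * (g⁻¹).val = Y := by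
      intro Y
      rw [Matrix.mul_assoc g.valᵀ, ← Matrix.mul_assoc, hut, Matrix.one_mul, Matrix.mul_assoc, hu,
        Matrix.mul_one]
    have h3 : g.valᵀ * Nᵀ * g.val = g.valᵀ * N * g.val := by
      simpa [transpose_mul, Matrix.mul_assoc] using h1
    rw [← h2 Nᵀ, h3, h2]
  -- The Hankel matrix λ(tⁱ⁺ʲ), where λ is the functional on F[t]/(t³ − τt² + σt − δ) with λ(1) =
  -- λ(t) = 0 and λ(t²) = 1.
  let A₀ : Matrix (Fin 3) (Fin 3) F := !![0, 0, 1; 0, 1, x.1; 1, x.1, x.1 ^ 2 - x.2.1]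
  have hA₀ : A₀ * companion x = (companion x)ᵀ * A₀ := by
    ext i j
    fin_cases i <;> fin_cases j <;>
      simp [A₀, companion, mul_apply, Fin.sum_univ_three] <;> ring
  have hdet : ((g⁻¹).valᵀ * A₀ * (g⁻¹).val).det ≠ 0 := by
    have h1 : A₀.det = -1 := by simp [A₀, det_fin_three]
    have h2 : (g⁻¹).val.det ≠ 0 := ((g⁻¹).val.isUnit_iff_isUnit_det.mp (g⁻¹).isUnit).ne_zero
    rw [det_mul, det_mul, det_transpose, h1]
    exact mul_ne_zero (mul_ne_zero h2 (by simp)) h2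
  refine ⟨GeneralLinearGroup.mkOfDetNeZero _ hdet, ?_, hsym⟩
  change (g⁻¹).valᵀ * A₀ * (g⁻¹).val * M = Mᵀ * ((g⁻¹).valᵀ * A₀ * (g⁻¹).val)
  have hg' : (g⁻¹).val * M = companion x * (g⁻¹).val := by
    have : (g⁻¹).val * (M * g.val) * (g⁻¹).val = (g⁻¹).val * (g.val * companion x) * (g⁻¹).val := by
      rw [hg]
    have hu : g.val * (g⁻¹).val = 1 := by simp
    have hu' : (g⁻¹).val * g.val = 1 := by simp
    rwa [Matrix.mul_assoc, Matrix.mul_assoc M, hu, Matrix.mul_one, ← Matrix.mul_assoc _ g.val, hu',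
      Matrix.one_mul] at this
  calc (g⁻¹).valᵀ * A₀ * (g⁻¹).val * M = (g⁻¹).valᵀ * (A₀ * companion x) * (g⁻¹).val := by
        rw [Matrix.mul_assoc, hg']; simp only [Matrix.mul_assoc]
    _ = (companion x * (g⁻¹).val)ᵀ * A₀ * (g⁻¹).val := by
        rw [hA₀, transpose_mul]; simp only [Matrix.mul_assoc]
    _ = _ := by rw [← hg', transpose_mul]; simp only [Matrix.mul_assoc]

/-- For each cubic with nonzero discriminant, the pairs of a nondegenerate symmetric matrix `A`
and an `A`-self-adjoint matrix with this characteristic polynomial are equinumerous with `GL₃`. -/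
lemma card_selfAdjoint {K : Type*} [Field K] [Fintype K] (h2 : (2 : K) ≠ 0)
    (hcard : 3 < Fintype.card K) {x : K × K × K} (hx : cubicDiscr x ≠ 0) :
    Nat.card {p : GL (Fin 3) K × Matrix (Fin 3) (Fin 3) K //
      p.1.valᵀ = p.1.val ∧ (p.1.val * p.2)ᵀ = p.1.val * p.2 ∧ charData p.2 = x} =
      Nat.card (GL (Fin 3) K) := by
  have hex : ∀ M : Matrix (Fin 3) (Fin 3) K, ∃ g S : GL (Fin 3) K, charData M = x →
      M * g.val = g.val * companion x ∧ S.val * M = Mᵀ * S.val ∧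
      ∀ N : Matrix (Fin 3) (Fin 3) K, N * M = Mᵀ * N → Nᵀ = N := by
    intro M
    by_cases hM : charData M = x
    · obtain ⟨v, hv⟩ := exists_krylov h2 hcard (M := M) (by rwa [hM])
      obtain ⟨g, hg⟩ := exists_mul_eq_mul_companion hv
      obtain ⟨S, hS⟩ := exists_symmetrizer hg
      exact ⟨g, S, fun _ => ⟨hM ▸ hg, hS⟩⟩
    -- Default values for matrices with other characteristic data.
    · exact ⟨1, 1, fun h => absurd h hM⟩
  choose g S hgS using hex
  have hconj : ∀ G : GL (Fin 3) K, charData (G.val * companion x * (G⁻¹).val) = x := by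
    intro G
    rw [charData_eq_of_mul_eq (N := companion x) (g := G), charData_companion]
    rw [Matrix.mul_assoc]; simp
  have hcan : ∀ (G : GL (Fin 3) K) (Y : Matrix (Fin 3) (Fin 3) K),
      (G⁻¹).val * (G.val * Y) = Y := by
    intro G Y; rw [← Matrix.mul_assoc]; simp
  -- The matrix G = S⁻¹Ag satisfies G·companion = MG, so G determines M by conjugation, and then A =
  -- SGg⁻¹. In the other direction symmetry of A comes for free, since every N with NM = MᵀN is
  -- symmetric.
  refine Nat.card_congr
    { toFun := fun p => (S p.1.2)⁻¹ * p.1.1 * g p.1.2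
      invFun := fun G =>
        ⟨(S (G.val * companion x * (G⁻¹).val) * G * (g (G.val * companion x * (G⁻¹).val))⁻¹,
          G.val * companion x * (G⁻¹).val), ?_⟩
      left_inv := ?_
      right_inv := ?_ }
  · set M := G.val * companion x * (G⁻¹).val with hM
    obtain ⟨h1, h2, h3⟩ := hgS M (hconj G)
    have hMG : M * G.val = G.val * companion x := by rw [hM, Matrix.mul_assoc]; simp
    have hgM : ((g M)⁻¹).val * M = companion x * ((g M)⁻¹).val := by
      have := congrArg (fun Y => ((g M)⁻¹).val * Y * ((g M)⁻¹).val) h1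
      simp only [hcan, Matrix.mul_assoc] at this
      simpa using this
    have hA : (S M * G * (g M)⁻¹).val * M = Mᵀ * (S M * G * (g M)⁻¹).val := by
      simp only [Units.val_mul, Matrix.mul_assoc]
      rw [hgM, ← Matrix.mul_assoc G.val, ← hMG, Matrix.mul_assoc, ← Matrix.mul_assoc (S M).val, h2]
      simp only [Matrix.mul_assoc]
    have hs := h3 _ hA
    refine ⟨hs, ?_, hconj G⟩
    rw [transpose_mul, hs, hA]
  · rintro ⟨⟨A, M⟩, hA, hAM, hMx⟩
    obtain ⟨h1, h2, h3⟩ := hgS M hMx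
    simp only
    rw [transpose_mul, hA] at hAM
    have key : ((S M)⁻¹ * A * g M).val * companion x * (((S M)⁻¹ * A * g M)⁻¹).val = M := by
      have e : ((S M)⁻¹ * A * g M).val * companion x = M * ((S M)⁻¹ * A * g M).val := by
        simp only [Units.val_mul, Matrix.mul_assoc]
        rw [← h1, ← Matrix.mul_assoc A.val, ← hAM]
        have : ((S M)⁻¹).val * Mᵀ = M * ((S M)⁻¹).val := by
          have := congrArg (fun Y => ((S M)⁻¹).val * Y * ((S M)⁻¹).val) h2
          simp only [hcan, Matrix.mul_assoc] at this
          simpa using this.symm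
        simp only [Matrix.mul_assoc]
        rw [← Matrix.mul_assoc _ Mᵀ, this]
        simp only [Matrix.mul_assoc]
      rw [e, Matrix.mul_assoc, ← Units.val_mul, mul_inv_cancel, Units.val_one, Matrix.mul_one]
    refine Subtype.ext (Prod.ext ?_ key)
    simp only [key]
    group
  · intro G
    simp only
    group

lemma card_symm_pairs {K : Type*} [Field K] [Fintype K] (h2 : (2 : K) ≠ 0)
    (hcard : 3 < Fintype.card K) {R : K × K × K → Prop} (hR : ∀ x, R x → cubicDiscr x ≠ 0) :
    Nat.card {p : Matrix (Fin 3) (Fin 3) K × Matrix (Fin 3) (Fin 3) K //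
      p.1ᵀ = p.1 ∧ p.2ᵀ = p.2 ∧ p.1.det ≠ 0 ∧ R (charData (p.1⁻¹ * p.2))} =
      Nat.card {x // R x} * Nat.card (GL (Fin 3) K) := by
  classical
  have e : {p : Matrix (Fin 3) (Fin 3) K × Matrix (Fin 3) (Fin 3) K //
      p.1ᵀ = p.1 ∧ p.2ᵀ = p.2 ∧ p.1.det ≠ 0 ∧ R (charData (p.1⁻¹ * p.2))} ≃
      (x : {x // R x}) × {p : GL (Fin 3) K × Matrix (Fin 3) (Fin 3) K //
      p.1.valᵀ = p.1.val ∧ (p.1.val * p.2)ᵀ = p.1.val * p.2 ∧ charData p.2 = x.1} :=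
    { toFun := fun p => ⟨⟨charData (p.1.1⁻¹ * p.1.2), p.2.2.2.2⟩,
        ⟨(GeneralLinearGroup.mkOfDetNeZero p.1.1 p.2.2.2.1, p.1.1⁻¹ * p.1.2), by
          have hu : IsUnit p.1.1.det := isUnit_iff_ne_zero.mpr p.2.2.2.1
          refine ⟨p.2.1, ?_, rfl⟩
          change (p.1.1 * (p.1.1⁻¹ * p.1.2))ᵀ = p.1.1 * (p.1.1⁻¹ * p.1.2)
          rw [mul_nonsing_inv_cancel_left _ _ hu, p.2.2.1]⟩⟩
      invFun := fun y => ⟨(y.2.1.1.val, y.2.1.1.val * y.2.1.2), by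
        have hu : IsUnit y.2.1.1.val.det := y.2.1.1.val.isUnit_iff_isUnit_det.mp y.2.1.1.isUnit
        refine ⟨y.2.2.1, y.2.2.2.1, hu.ne_zero, ?_⟩
        simp only
        rw [nonsing_inv_mul_cancel_left _ _ hu, y.2.2.2.2]
        exact y.1.2⟩
      left_inv := by
        rintro ⟨⟨A, B⟩, h⟩
        have hu : IsUnit A.det := isUnit_iff_ne_zero.mpr h.2.2.1
        refine Subtype.ext (Prod.ext rfl ?_)
        exact mul_nonsing_inv_cancel_left _ _ hu
      right_inv := by
        rintro ⟨⟨x, hx⟩, ⟨⟨A, M⟩, hA, hAM, hM⟩⟩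
        have hu : IsUnit A.val.det := A.val.isUnit_iff_isUnit_det.mp A.isUnit
        simp only at hM
        subst hM
        have e : A.val⁻¹ * (A.val * M) = M := nonsing_inv_mul_cancel_left _ _ hu
        refine Sigma.subtype_ext (Subtype.ext ?_) (Prod.ext (Units.ext rfl) ?_)
        · exact congrArg charData e
        · exact e }
  rw [Nat.card_congr e, Nat.card_sigma, Finset.sum_congr rfl
    (fun (y : {x // R x}) _ => card_selfAdjoint h2 hcard (hR y.1 y.2))]
  simp

/-! ### Pairs of symmetric bilinear forms on a three-dimensional space -/

section Forms

variable {F : Type*} [Field F]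

/-- The bilinear form with Gram matrix `A`. -/
def bil (A : Matrix (Fin 3) (Fin 3) F) (x y : Fin 3 → F) : F := x ⬝ᵥ A *ᵥ y

lemma bil_comm {A : Matrix (Fin 3) (Fin 3) F} (hA : Aᵀ = A) (x y : Fin 3 → F) :
    bil A x y = bil A y x := by
  unfold bil
  rw [dotProduct_mulVec, dotProduct_comm, ← mulVec_transpose, hA]

lemma bil_add_left (A : Matrix (Fin 3) (Fin 3) F) (x y z : Fin 3 → F) :
    bil A (x + y) z = bil A x z + bil A y z := add_dotProduct _ _ _

lemma bil_add_right (A : Matrix (Fin 3) (Fin 3) F) (x y z : Fin 3 → F) :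
    bil A x (y + z) = bil A x y + bil A x z := by simp [bil, mulVec_add]

lemma bil_smul_left (A : Matrix (Fin 3) (Fin 3) F) (c : F) (x y : Fin 3 → F) :
    bil A (c • x) y = c * bil A x y := by simp [bil]

lemma bil_smul_right (A : Matrix (Fin 3) (Fin 3) F) (c : F) (x y : Fin 3 → F) :
    bil A x (c • y) = c * bil A x y := by simp [bil, mulVec_smul]

/-- The Gram matrix of `A` with respect to three vectors. -/
def gram (A : Matrix (Fin 3) (Fin 3) F) (v : Fin 3 → Fin 3 → F) : Matrix (Fin 3) (Fin 3) F :=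
  of v * A * (of v)ᵀ

lemma gram_apply (A : Matrix (Fin 3) (Fin 3) F) (v : Fin 3 → Fin 3 → F) (i j : Fin 3) :
    gram A v i j = bil A (v i) (v j) := by
  unfold gram bil
  rw [dotProduct_mulVec, Matrix.mul_apply]
  rfl

lemma det_gram (A : Matrix (Fin 3) (Fin 3) F) (v : Fin 3 → Fin 3 → F) :
    (gram A v).det = (of v).det ^ 2 * A.det := by
  rw [gram, det_mul, det_mul, det_transpose]; ring

lemma gram_eq {A : Matrix (Fin 3) (Fin 3) F} (hA : Aᵀ = A) (x y z : Fin 3 → F) :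
    gram A ![x, y, z] = !![bil A x x, bil A x y, bil A x z; bil A x y, bil A y y, bil A y z;
      bil A x z, bil A y z, bil A z z] := by
  ext i j
  rw [gram_apply]
  fin_cases i <;> fin_cases j <;> simp [bil_comm hA]

/-- The coefficients of `det (t A + B)` are, up to the factor `det A`, the characteristic data of
`A⁻¹ B`. -/
lemma pencil_eq {A : Matrix (Fin 3) (Fin 3) F} (B : Matrix (Fin 3) (Fin 3) F) (hA : A.det ≠ 0) :
    A.det * (charData (A⁻¹ * B)).1 = (A.adjugate * B).trace ∧
      A.det * (charData (A⁻¹ * B)).2.1 = (B.adjugate * A).trace ∧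
      A.det * (charData (A⁻¹ * B)).2.2 = B.det := by
  have hu : IsUnit A.det := isUnit_iff_ne_zero.mpr hA
  obtain ⟨M, rfl⟩ : ∃ M, B = A * M := ⟨A⁻¹ * B, (mul_nonsing_inv_cancel_left _ _ hu).symm⟩
  rw [nonsing_inv_mul_cancel_left _ _ hu]
  refine ⟨?_, ?_, ?_⟩
  · rw [← Matrix.mul_assoc, adjugate_mul, smul_mul, Matrix.one_mul, trace_smul]; rfl
  · rw [adjugate_mul_distrib, Matrix.mul_assoc, adjugate_mul, Matrix.mul_smul, Matrix.mul_one,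
      trace_smul]; rfl
  · rw [det_mul]; rfl

lemma charData_gram {A B : Matrix (Fin 3) (Fin 3) F} (hA : A.det ≠ 0) {v : Fin 3 → Fin 3 → F}
    (hv : (of v).det ≠ 0) :
    charData ((gram A v)⁻¹ * gram B v) = charData (A⁻¹ * B) := by
  have hd : (of v)ᵀ.det ≠ 0 := by rwa [det_transpose]
  have hu : IsUnit A.det := isUnit_iff_ne_zero.mpr hA
  have huv : IsUnit (of v).det := isUnit_iff_ne_zero.mpr hv
  have hug : IsUnit (gram A v).det := by
    rw [det_gram]; exact isUnit_iff_ne_zero.mpr (mul_ne_zero (pow_ne_zero 2 hv) hA)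
  symm
  refine charData_eq_of_mul_eq (g := GeneralLinearGroup.mkOfDetNeZero _ hd) ?_
  change A⁻¹ * B * (of v)ᵀ = (of v)ᵀ * ((gram A v)⁻¹ * gram B v)
  have h1 : gram A v * (((of v)ᵀ)⁻¹ * (A⁻¹ * B * (of v)ᵀ)) = gram B v := by
    unfold gram
    rw [Matrix.mul_assoc _ (of v)ᵀ, mul_nonsing_inv_cancel_left _ _ (isUnit_iff_ne_zero.mpr hd),
      Matrix.mul_assoc (of v), Matrix.mul_assoc A⁻¹, mul_nonsing_inv_cancel_left _ _ hu,
      Matrix.mul_assoc]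
  rw [← h1, nonsing_inv_mul_cancel_left _ _ hug,
    mul_nonsing_inv_cancel_left _ _ (isUnit_iff_ne_zero.mpr hd)]

/-- This allows the invariants to be computed, without denominators, in any basis adapted to the
geometry. -/
lemma pencil_gram {A : Matrix (Fin 3) (Fin 3) F} (B : Matrix (Fin 3) (Fin 3) F)
    (hA : A.det ≠ 0) {v : Fin 3 → Fin 3 → F} (hv : (of v).det ≠ 0) :
    (gram A v).det ≠ 0 ∧
      (gram A v).det * (charData (A⁻¹ * B)).1 = ((gram A v).adjugate * gram B v).trace ∧
      (gram A v).det * (charData (A⁻¹ * B)).2.1 = ((gram B v).adjugate * gram A v).trace ∧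
      (gram A v).det * (charData (A⁻¹ * B)).2.2 = (gram B v).det := by
  have h : (gram A v).det ≠ 0 := by
    rw [det_gram]; exact mul_ne_zero (pow_ne_zero 2 hv) hA
  exact ⟨h, charData_gram (B := B) hA hv ▸ pencil_eq (gram B v) h⟩

lemma eq_zero_of_dotProduct {v : Fin 3 → Fin 3 → F} (hv : (of v).det ≠ 0) {w : Fin 3 → F}
    (h : ∀ i, v i ⬝ᵥ w = 0) : w = 0 :=
  eq_zero_of_mulVec_eq_zero hv (funext h)

lemma eq_zero_of_bil {A : Matrix (Fin 3) (Fin 3) F} (hA : A.det ≠ 0) {x y z w : Fin 3 → F}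
    (hv : (of ![x, y, z]).det ≠ 0) (hx : bil A x w = 0) (hy : bil A y w = 0)
    (hz : bil A z w = 0) : w = 0 := by
  refine eq_zero_of_mulVec_eq_zero hA (eq_zero_of_dotProduct hv fun i => ?_)
  fin_cases i
  exacts [hx, hy, hz]

lemma exists_det_ne_zero_of_pair {x y : Fin 3 → F} (h : LinearIndependent F ![x, y]) :
    ∃ z, (of ![x, y, z]).det ≠ 0 := by
  have hc := crossProduct_ne_zero_iff_linearIndependent.mpr h
  obtain ⟨i, hi⟩ := Function.ne_iff.mp hc
  refine ⟨Pi.single i 1, ?_⟩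
  have h1 : (of ![x, y, Pi.single i 1]).det = (crossProduct x y) ⬝ᵥ Pi.single i 1 := by
    simp only [vec3_dotProduct, cross_apply, det_fin_three, of_apply, cons_val]
    ring
  rw [h1]
  simpa using hi

lemma exists_linearIndependent_pair {x : Fin 3 → F} (hx : x ≠ 0) :
    ∃ y, LinearIndependent F ![x, y] := by
  by_contra! h
  have h0 : ∀ y, crossProduct x y = 0 := fun y => by
    by_contra hne
    exact h y (crossProduct_ne_zero_iff_linearIndependent.mp hne)
  apply hx
  have e0 := h0 (Pi.single 0 1)
  have e1 := h0 (Pi.single 1 1)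
  simp [cross_apply] at e0 e1
  ext i
  fin_cases i <;> simp [*]

lemma exists_det_ne_zero {x : Fin 3 → F} (hx : x ≠ 0) :
    ∃ y z, (of ![x, y, z]).det ≠ 0 := by
  obtain ⟨y, hy⟩ := exists_linearIndependent_pair hx
  obtain ⟨z, hz⟩ := exists_det_ne_zero_of_pair hy
  exact ⟨y, z, hz⟩

lemma linearIndependent_of_det {x y z : Fin 3 → F} (h : (of ![x, y, z]).det ≠ 0) :
    LinearIndependent F ![x, y, z] :=
  linearIndependent_rows_iff_isUnit.mpr
    ((of ![x, y, z]).isUnit_iff_isUnit_det.mpr (isUnit_iff_ne_zero.mpr h))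

/-- A nondegenerate form on a three-dimensional space has no isotropic plane. -/
lemma bil_ne_zero_of_isotropic {A : Matrix (Fin 3) (Fin 3) F} (hA : Aᵀ = A) (hd : A.det ≠ 0)
    {x y : Fin 3 → F} (h : LinearIndependent F ![x, y]) (hx : bil A x x = 0)
    (hy : bil A y y = 0) : bil A x y ≠ 0 := by
  intro hxy
  obtain ⟨z, hz⟩ := exists_det_ne_zero_of_pair h
  have := det_gram A ![x, y, z]
  rw [gram_eq hA, hx, hy, hxy] at this
  refine mul_ne_zero (pow_ne_zero 2 hz) hd (this.symm.trans ?_)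
  simp [det_fin_three]

/-- Three distinct points of a smooth conic are not collinear. -/
lemma det_ne_zero_of_isotropic (h2 : (2 : F) ≠ 0) {A : Matrix (Fin 3) (Fin 3) F} (hA : Aᵀ = A)
    (hd : A.det ≠ 0) {x y z : Fin 3 → F} (hxy : LinearIndependent F ![x, y])
    (hyz : LinearIndependent F ![y, z]) (hxz : LinearIndependent F ![x, z])
    (hx : bil A x x = 0) (hy : bil A y y = 0) (hz : bil A z z = 0) :
    (of ![x, y, z]).det ≠ 0 := by
  intro h
  have := det_gram A ![x, y, z]
  have h1 := bil_ne_zero_of_isotropic hA hd hxy hx hy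
  have h2 := bil_ne_zero_of_isotropic hA hd hyz hy hz
  have h3 := bil_ne_zero_of_isotropic hA hd hxz hx hz
  rw [gram_eq hA, hx, hy, hz, h] at this
  have h4 : 2 * (bil A x y * bil A y z * bil A x z) = 0 := by
    simp [det_fin_three] at this
    linear_combination this
  simp_all

/-! ### Tangency and double roots -/

/-- In a basis starting with q, the first row and the first column of B − tA are both divisible by r
− t and the corner entry is 0, so (r − t)² divides the determinant. -/
lemma charData_of_tangent {A B : Matrix (Fin 3) (Fin 3) F} (hA : Aᵀ = A) (hB : Bᵀ = B)
    (hd : A.det ≠ 0) {q : Fin 3 → F} (hq : q ≠ 0) (hqq : bil A q q = 0) {r : F}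
    (hr : B *ᵥ q = r • A *ᵥ q) : ∃ s, charData (A⁻¹ * B) = doubleRoot r s := by
  obtain ⟨y, z, hv⟩ := exists_det_ne_zero hq
  obtain ⟨hg, h1, h2, h3⟩ := pencil_gram B hd hv
  have hb : ∀ x, bil B q x = r * bil A q x := fun x => by
    rw [bil_comm hB, bil_comm hA]
    unfold bil
    rw [hr, dotProduct_smul, smul_eq_mul]
  rw [gram_eq hA, hqq] at hg
  rw [gram_eq hA, gram_eq hB, hqq, hb, hb, hb, hqq] at h1 h2 h3
  generalize charData (A⁻¹ * B) = x at *
  obtain ⟨τ, σ, δ⟩ := x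
  refine ⟨τ - 2 * r, ?_⟩
  simp only [doubleRoot, Prod.mk.injEq]
  generalize hD : det !![0, bil A q y, bil A q z; bil A q y, bil A y y, bil A y z;
      bil A q z, bil A y z, bil A z z] = D at *
  refine ⟨by ring, mul_left_cancel₀ hg ?_, mul_left_cancel₀ hg ?_⟩
  · simp [trace_fin_three, adjugate_fin_three] at h1 h2
    simp [det_fin_three] at hD
    linear_combination h2 - 2 * r * h1 - 3 * r ^ 2 * hD
  · simp [trace_fin_three, adjugate_fin_three] at h1
    simp [det_fin_three] at hD h3
    linear_combination h3 - r ^ 2 * h1 - 2 * r ^ 3 * hD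

lemma exists_binary_zero [IsAlgClosed F] (a b c : F) :
    ∃ x y : F, (x ≠ 0 ∨ y ≠ 0) ∧ a * x ^ 2 + 2 * b * x * y + c * y ^ 2 = 0 := by
  by_cases ha : a = 0
  · exact ⟨1, 0, Or.inl one_ne_zero, by simp [ha]⟩
  · obtain ⟨z, hz⟩ := IsAlgClosed.exists_pow_nat_eq (b ^ 2 - a * c) (n := 2) two_pos
    refine ⟨z - b, a, Or.inr ha, ?_⟩
    linear_combination a * hz

lemma exists_isotropic [IsAlgClosed F] {A : Matrix (Fin 3) (Fin 3) F} (hA : Aᵀ = A)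
    {x y : Fin 3 → F} (h : LinearIndependent F ![x, y]) :
    ∃ a b : F, (a ≠ 0 ∨ b ≠ 0) ∧ a • x + b • y ≠ 0 ∧ bil A (a • x + b • y) (a • x + b • y) = 0 := by
  obtain ⟨a, b, hab, hz⟩ := exists_binary_zero (bil A x x) (bil A x y) (bil A y y)
  refine ⟨a, b, hab, fun h0 => ?_, ?_⟩
  · obtain ⟨h1, h2⟩ := LinearIndependent.pair_iff.mp h a b h0
    simp_all
  · simp only [bil_add_left, bil_add_right, bil_smul_left, bil_smul_right, bil_comm hA y x]
    linear_combination hz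

/-- Take q in the kernel of C = B − rA. If A(q, q) ≠ 0, the double root forces the complementary 2×2
minor of C to vanish. The kernel then contains a plane, and a plane always contains an A-isotropic
vector. -/
lemma exists_tangent_of_charData [IsAlgClosed F] {A B : Matrix (Fin 3) (Fin 3) F} (hA : Aᵀ = A)
    (hB : Bᵀ = B) (hd : A.det ≠ 0) {r s : F} (h : charData (A⁻¹ * B) = doubleRoot r s) :
    ∃ q, q ≠ 0 ∧ bil A q q = 0 ∧ B *ᵥ q = r • A *ᵥ q := by
  have hu : IsUnit A.det := isUnit_iff_ne_zero.mpr hd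
  have hC : (B - r • A)ᵀ = B - r • A := by rw [transpose_sub, transpose_smul, hA, hB]
  have hker : ∀ q, (B - r • A) *ᵥ q = 0 → B *ᵥ q = r • A *ᵥ q := fun q hq => by
    rw [sub_mulVec, smul_mulVec] at hq
    exact sub_eq_zero.mp hq
  have hdet : (B - r • A).det = 0 := by
    have h1 : B - r • A = A * (A⁻¹ * B - r • (1 : Matrix (Fin 3) (Fin 3) F)) := by
      rw [Matrix.mul_sub, mul_nonsing_inv_cancel_left _ _ hu]; simp
    rw [h1, det_mul, det_smul_one_sub, h]
    simp only [doubleRoot]; ring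
  obtain ⟨q, hq, hCq⟩ := exists_mulVec_eq_zero_iff.mpr hdet
  by_cases hqq : bil A q q = 0
  · exact ⟨q, hq, hqq, hker q hCq⟩
  obtain ⟨y, z, hv⟩ := exists_det_ne_zero hq
  obtain ⟨hg, h1, h2, h3⟩ := pencil_gram B hd hv
  have hbC : ∀ u w, bil B u w = bil (B - r • A) u w + r * bil A u w := fun u w => by
    simp [bil, sub_mulVec, smul_mulVec]
  have hq0 : ∀ x, bil (B - r • A) q x = 0 := fun x => by
    rw [bil_comm hC, bil, hCq, dotProduct_zero]
  set C := B - r • A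
  have hminor : bil C y y * bil C z z - bil C y z ^ 2 = 0 := by
    rw [gram_eq hA, gram_eq hB, h] at h1 h2
    simp only [hbC, hq0, doubleRoot] at h1 h2
    refine (mul_eq_zero.mp (?_ : bil A q q * _ = 0)).resolve_left hqq
    simp [trace_fin_three, adjugate_fin_three, det_fin_three] at h1 h2
    linear_combination 2 * r * h1 - h2
  obtain ⟨a, b, hab, e1, e2⟩ : ∃ a b : F, (a ≠ 0 ∨ b ≠ 0) ∧ a * bil C y y + b * bil C y z = 0 ∧
      a * bil C y z + b * bil C z z = 0 := by
    by_cases hy : bil C y y = 0 ∧ bil C y z = 0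
    · exact ⟨1, 0, by simp, by simp [hy], by simp [hy]⟩
    · refine ⟨bil C y z, -bil C y y, ?_, by ring, by linear_combination -hminor⟩
      by_contra! h0
      exact hy ⟨neg_eq_zero.mp h0.2, h0.1⟩
  have hli := linearIndependent_of_det hv
  have hCw : C *ᵥ (a • y + b • z) = 0 := by
    refine eq_zero_of_dotProduct hv fun i => ?_
    change bil C _ _ = 0
    fin_cases i
    · exact hq0 _
    · simp [bil_add_right, bil_smul_right, e1]
    · simp [bil_add_right, bil_smul_right, bil_comm hC z y, e2]
  have hpair : LinearIndependent F ![q, a • y + b • z] := by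
    rw [LinearIndependent.pair_iff]
    intro c d hcd
    rw [Fintype.linearIndependent_iff] at hli
    have := hli ![c, d * a, d * b] (by
      rw [Fin.sum_univ_three]
      simp only [cons_val_zero, cons_val_one, cons_val]
      rw [← hcd, smul_add, smul_smul, smul_smul]; abel)
    have c0 := this 0
    have c1 := this 1
    have c2 := this 2
    simp at c0 c1 c2
    refine ⟨c0, ?_⟩
    by_contra hd0
    simp_all
  obtain ⟨c, d, -, hne, h0⟩ := exists_isotropic hA hpair
  refine ⟨_, hne, h0, hker _ ?_⟩
  rw [mulVec_add, mulVec_smul, mulVec_smul, hCq, hCw]; simp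

end Forms

/-! ### Cayley's criterion in terms of Gram matrices -/

section Triangles

variable {F : Type*} [Field F]

lemma exists_coords {x y z : Fin 3 → F} (h : (of ![x, y, z]).det ≠ 0) (w : Fin 3 → F) :
    ∃ a b c : F, w = a • x + b • y + c • z := by
  have hu : IsUnit (of ![x, y, z]).det := isUnit_iff_ne_zero.mpr h
  set u := w ᵥ* (of ![x, y, z])⁻¹ with hu'
  have hw : u ᵥ* of ![x, y, z] = w := by
    rw [hu', vecMul_vecMul, nonsing_inv_mul _ hu, vecMul_one]
  refine ⟨u 0, u 1, u 2, ?_⟩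
  rw [← hw]
  ext i
  simp [vecMul, dotProduct, Fin.sum_univ_three]

lemma det_rotate (x y z : Fin 3 → F) : (of ![y, z, x]).det = (of ![x, y, z]).det := by
  simp only [det_fin_three, of_apply, cons_val]
  ring

/-- The line through `x` and `y` touches the conic `B`, so that the restriction of `B` to it is
degenerate. -/
lemma minor_eq_zero_of_tangent {B : Matrix (Fin 3) (Fin 3) F} (hB : Bᵀ = B) (hd : B.det ≠ 0)
    {x y z q : Fin 3 → F} (h : (of ![x, y, z]).det ≠ 0) (hq : q ≠ 0) (hqq : bil B q q = 0)
    (hx : bil B x q = 0) (hy : bil B y q = 0) :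
    bil B x x * bil B y y - bil B x y ^ 2 = 0 := by
  obtain ⟨a, b, c, rfl⟩ := exists_coords h q
  have hz : bil B z (a • x + b • y + c • z) ≠ 0 := fun hz => hq (eq_zero_of_bil hd h hx hy hz)
  -- The contact point lies on its own tangent line xy: B(q, q) reduces to c·B(z, q).
  have hc : c = 0 := by
    rw [bil_add_left, bil_add_left, bil_smul_left, bil_smul_left, bil_smul_left, hx, hy] at hqq
    simpa [hz] using hqq
  subst hc
  simp only [bil_add_right, bil_smul_right, zero_mul, add_zero, bil_comm hB y x] at hx hy
  by_contra hne
  have ha : a = 0 := by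
    refine (mul_eq_zero.mp (?_ : a * (bil B x x * bil B y y - bil B x y ^ 2) = 0)).resolve_right hne
    linear_combination bil B y y * hx - bil B x y * hy
  have hb : b = 0 := by
    refine (mul_eq_zero.mp (?_ : b * (bil B x x * bil B y y - bil B x y ^ 2) = 0)).resolve_right hne
    linear_combination bil B x x * hy - bil B x y * hx
  exact hq (by simp [ha, hb])

/-- In the basis of vertices, A has zero diagonal because they lie on A, and adj B has zero diagonal
because the sides touch B. With off-diagonal entries u, v, w of A and u', v', w' of adj B, put s =
uu' + vv' + ww'. Then tr(adj B·A) = 2s, while det B·tr(adj A·B) = tr(adj A·adj(adj B)) = s². -/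
lemma sq_eq_of_triangle {A B : Matrix (Fin 3) (Fin 3) F} (hA : Aᵀ = A) (hB : Bᵀ = B)
    (hdA : A.det ≠ 0) {x y z : Fin 3 → F}
    (h : (of ![x, y, z]).det ≠ 0)
    (hx : bil A x x = 0) (hy : bil A y y = 0) (hz : bil A z z = 0)
    (hxy : bil B x x * bil B y y - bil B x y ^ 2 = 0)
    (hyz : bil B y y * bil B z z - bil B y z ^ 2 = 0)
    (hxz : bil B x x * bil B z z - bil B x z ^ 2 = 0) :
    (charData (A⁻¹ * B)).2.1 ^ 2 = 4 * (charData (A⁻¹ * B)).2.2 * (charData (A⁻¹ * B)).1 := by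
  obtain ⟨hg, h1, h2, h3⟩ := pencil_gram B hdA h
  rw [gram_eq hA, gram_eq hB, hx, hy, hz] at h1 h2 h3
  rw [gram_eq hA, hx, hy, hz] at hg
  refine mul_left_cancel₀ (pow_ne_zero 2 hg) ?_
  generalize det !![0, bil A x y, bil A x z; bil A x y, 0, bil A y z;
      bil A x z, bil A y z, 0] = D at *
  simp [trace_fin_three, adjugate_fin_three] at h1 h2
  rw [det_fin_three] at h3
  simp at h3
  generalize bil B x x = a at *
  generalize bil B y y = b at *
  generalize bil B z z = c at *
  generalize bil B y z = d at *
  generalize bil B x z = e at *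
  generalize bil B x y = f at *
  generalize bil A y z = u at *
  generalize bil A x z = v at *
  generalize bil A x y = w at *
  have h2' : D * (charData (A⁻¹ * B)).2.1 =
      2 * (u * (e * f - a * d) + v * (d * f - b * e) + w * (d * e - c * f)) := by
    rw [h2]; ring
  have h13 : D * (charData (A⁻¹ * B)).2.2 * (D * (charData (A⁻¹ * B)).1) =
      (u * (e * f - a * d) + v * (d * f - b * e) + w * (d * e - c * f)) ^ 2 := by
    rw [h1, h3]
    linear_combination (-u ^ 2 * (a * c - e ^ 2) - v ^ 2 * (b * c - d ^ 2)
      - 2 * u * v * (d * e - c * f)) * hxy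
      + (-w ^ 2 * (a * c - e ^ 2) - 2 * v * w * (e * f - a * d)) * hyz
      - 2 * u * w * (d * f - b * e) * hxz
  linear_combination (D * (charData (A⁻¹ * B)).2.1 +
    2 * (u * (e * f - a * d) + v * (d * f - b * e) + w * (d * e - c * f))) * h2' - 4 * h13

/-- Here σ² − 4δτ is, up to a nonzero square, 8·B(p,p)·B(q,r)³·A(p,q)·A(p,r), and only the last
factor can vanish. Its vanishing says that the line pr touches A at p. -/
lemma sq_eq_iff_of_degenerate (h2 : (2 : F) ≠ 0) {A B : Matrix (Fin 3) (Fin 3) F} (hA : Aᵀ = A)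
    (hB : Bᵀ = B) (hdA : A.det ≠ 0) (hdB : B.det ≠ 0) {p q r : Fin 3 → F}
    (h : (of ![p, q, r]).det ≠ 0)
    (hpp : bil A p p = 0) (hqq : bil A q q = 0) (hpq : bil A p q ≠ 0)
    (hqq' : bil B q q = 0) (hrr' : bil B r r = 0) (hpq' : bil B p q = 0) (hpr' : bil B p r = 0) :
    (charData (A⁻¹ * B)).2.1 ^ 2 = 4 * (charData (A⁻¹ * B)).2.2 * (charData (A⁻¹ * B)).1 ↔
      bil A p r = 0 := by
  obtain ⟨hg, h1, h2', h3⟩ := pencil_gram B hdA h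
  have hgB : (gram B ![p, q, r]).det ≠ 0 := by
    rw [det_gram]; exact mul_ne_zero (pow_ne_zero 2 h) hdB
  rw [gram_eq hA, gram_eq hB, hpp, hqq, hqq', hrr', hpq', hpr'] at h1 h2' h3
  rw [gram_eq hA, hpp, hqq] at hg
  rw [gram_eq hB, hqq', hrr', hpq', hpr', det_fin_three] at hgB
  simp at hgB
  generalize det !![0, bil A p q, bil A p r; bil A p q, 0, bil A q r;
      bil A p r, bil A q r, bil A r r] = D at *
  simp [trace_fin_three, adjugate_fin_three] at h1 h2'
  rw [det_fin_three] at h3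
  simp at h3
  have key : D ^ 2 * ((charData (A⁻¹ * B)).2.1 ^ 2 -
      4 * (charData (A⁻¹ * B)).2.2 * (charData (A⁻¹ * B)).1) =
      2 ^ 3 * bil B p p * bil B q r ^ 3 * bil A p q * bil A p r := by
    have : D ^ 2 * ((charData (A⁻¹ * B)).2.1 ^ 2 -
      4 * (charData (A⁻¹ * B)).2.2 * (charData (A⁻¹ * B)).1) =
      (D * (charData (A⁻¹ * B)).2.1) ^ 2 -
        4 * (D * (charData (A⁻¹ * B)).2.2) * (D * (charData (A⁻¹ * B)).1) := by ring
    rw [this, h1, h2', h3]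
    ring
  rw [← sub_eq_zero, ← mul_eq_zero_iff_left (pow_ne_zero 2 hg), key]
  simp [hgB, hpq, h2]

/-- The pencil has a degenerate member B − rA with a kernel vector v. Joining v to another zero of
this member gives a line contained in it, and that line meets A. -/
lemma exists_common_zero [IsAlgClosed F] {A B : Matrix (Fin 3) (Fin 3) F} (hA : Aᵀ = A)
    (hB : Bᵀ = B) (hdA : A.det ≠ 0) : ∃ q, q ≠ 0 ∧ bil A q q = 0 ∧ bil B q q = 0 := by
  have hu : IsUnit A.det := isUnit_iff_ne_zero.mpr hdA
  obtain ⟨r, hr⟩ := Module.End.exists_eigenvalue (Matrix.toLin' (A⁻¹ * B))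
  obtain ⟨v, hv⟩ := hr.exists_hasEigenvector
  have hBv : B *ᵥ v = r • A *ᵥ v := by
    have := hv.apply_eq_smul
    rw [toLin'_apply] at this
    rw [← mulVec_smul, ← this, mulVec_mulVec, mul_nonsing_inv_cancel_left _ _ hu]
  have hC : (B - r • A)ᵀ = B - r • A := by rw [transpose_sub, transpose_smul, hA, hB]
  have hbC : ∀ u w, bil B u w = bil (B - r • A) u w + r * bil A u w := fun u w => by
    simp [bil, sub_mulVec, smul_mulVec]
  have hCv : ∀ x, bil (B - r • A) x v = 0 := fun x => by
    rw [bil, sub_mulVec, smul_mulVec, hBv, sub_self, dotProduct_zero]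
  obtain ⟨y, z, hdet⟩ := exists_det_ne_zero hv.2
  have hli := linearIndependent_of_det hdet
  have hli2 : LinearIndependent F ![y, z] := by
    refine LinearIndependent.pair_iff.mpr fun c d hcd => ?_
    have := Fintype.linearIndependent_iff.mp hli ![0, c, d] (by simpa [Fin.sum_univ_three] using hcd)
    exact ⟨this 1, this 2⟩
  obtain ⟨a, b, hab, hw0, hw⟩ := exists_isotropic hC hli2
  have hpair : LinearIndependent F ![v, a • y + b • z] := by
    rw [LinearIndependent.pair_iff]
    intro c d hcd
    rw [Fintype.linearIndependent_iff] at hli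
    have := hli ![c, d * a, d * b] (by
      rw [Fin.sum_univ_three]
      simp only [cons_val_zero, cons_val_one, cons_val]
      rw [← hcd, smul_add, smul_smul, smul_smul]; abel)
    have c0 := this 0
    have c1 := this 1
    have c2 := this 2
    simp at c0 c1 c2
    refine ⟨c0, ?_⟩
    by_contra hd0
    simp_all
  obtain ⟨c, d, -, hne, h0⟩ := exists_isotropic hA hpair
  refine ⟨_, hne, h0, ?_⟩
  rw [hbC, h0, mul_zero, add_zero]
  rw [bil_add_right, bil_smul_right, hCv, bil_comm hC, bil_add_right, bil_smul_right, hCv,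
    bil_smul_right, bil_smul_left, hw]
  ring

lemma exists_degenerate_configuration [IsAlgClosed F] (h2 : (2 : F) ≠ 0)
    {A B : Matrix (Fin 3) (Fin 3) F}
    (hA : Aᵀ = A) (hB : Bᵀ = B) (hdA : A.det ≠ 0) (hdB : B.det ≠ 0)
    (htr : ∀ x, x ≠ 0 → bil A x x = 0 → bil B x x = 0 →
      LinearIndependent F ![A *ᵥ x, B *ᵥ x]) :
    ∃ p q r : Fin 3 → F, (of ![p, q, r]).det ≠ 0 ∧ bil A p p = 0 ∧ bil A q q = 0 ∧
      bil A p q ≠ 0 ∧ bil B q q = 0 ∧ bil B r r = 0 ∧ bil B p q = 0 ∧ bil B p r = 0 := by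
  obtain ⟨q, hq, hAq, hBq⟩ := exists_common_zero hA hB hdA
  have hli := htr q hq hAq hBq
  obtain ⟨p, hpp, hpq, hAp⟩ : ∃ p, bil A p p = 0 ∧ bil B p q = 0 ∧ bil A p q ≠ 0 := by
    -- By transversality the tangent to B at q is not tangent to A, so some s lies on the first
    -- tangent line and not on the second.
    obtain ⟨s, hs1, hs2⟩ : ∃ s, bil B s q = 0 ∧ bil A s q ≠ 0 := by
      by_contra! hall
      obtain ⟨z, hz⟩ := exists_det_ne_zero_of_pair hli
      have hu : IsUnit (of ![A *ᵥ q, B *ᵥ q, z]).det := isUnit_iff_ne_zero.mpr hz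
      have hs : of ![A *ᵥ q, B *ᵥ q, z] *ᵥ ((of ![A *ᵥ q, B *ᵥ q, z])⁻¹ *ᵥ ![1, 0, 0]) =
          ![1, 0, 0] := by
        rw [mulVec_mulVec, mul_nonsing_inv _ hu, one_mulVec]
      set s := (of ![A *ᵥ q, B *ᵥ q, z])⁻¹ *ᵥ ![1, 0, 0]
      have e0 : A *ᵥ q ⬝ᵥ s = 1 := congrFun hs 0
      have e1 : B *ᵥ q ⬝ᵥ s = 0 := congrFun hs 1
      have := hall s (by rw [bil, dotProduct_comm, e1])
      rw [bil, dotProduct_comm, e0] at this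
      exact one_ne_zero this
    -- Since A(q, q) = 0, the condition that s + cq lies on A is linear in c.
    refine ⟨s + (-bil A s s / (2 * bil A s q)) • q, ?_, ?_, ?_⟩
    · simp only [bil_add_left, bil_add_right, bil_smul_left, bil_smul_right, hAq, bil_comm hA q s]
      field_simp
      ring
    · simp [bil_add_left, bil_smul_left, hs1, hBq]
    · simpa [bil_add_left, bil_smul_left, hAq] using hs2
  have hlpq : LinearIndependent F ![p, q] := by
    rw [LinearIndependent.pair_iff]
    intro a b hab
    have hb : b = 0 := by
      have := congrArg (bil A p) hab
      rw [bil_add_right, bil_smul_right, bil_smul_right, hpp] at this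
      have h0 : ∀ x, bil A x 0 = 0 := fun x => by simp [bil]
      simpa [h0, hAp] using this
    have ha : a = 0 := by
      have := congrArg (bil A q) hab
      rw [bil_add_right, bil_smul_right, bil_smul_right, hAq, bil_comm hA] at this
      have h0 : ∀ x, bil A x 0 = 0 := fun x => by simp [bil]
      simpa [h0, hAp] using this
    exact ⟨ha, hb⟩
  have hBp : bil B p p ≠ 0 := fun h => bil_ne_zero_of_isotropic hB hdB hlpq h hBq hpq
  -- The polar line of p with respect to B contains both contact points of the tangents from p; r is
  -- the one other than q.
  obtain ⟨r, hrr, hpr, hqr⟩ : ∃ r, bil B r r = 0 ∧ bil B p r = 0 ∧ bil B q r ≠ 0 := by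
    obtain ⟨s, hs1, hs2⟩ : ∃ s, bil B p s = 0 ∧ bil B q s ≠ 0 := by
      obtain ⟨t, ht⟩ := exists_det_ne_zero_of_pair hlpq
      have htq : bil B q t ≠ 0 := fun h0 => hq (eq_zero_of_bil hdB ht hpq hBq
        (by rw [bil_comm hB, h0]))
      refine ⟨t + (-bil B p t / bil B p p) • p, ?_, ?_⟩
      · simp only [bil_add_right, bil_smul_right]
        field_simp
        ring
      · simpa [bil_add_right, bil_smul_right, bil_comm hB q p, hpq] using htq
    refine ⟨s + (-bil B s s / (2 * bil B q s)) • q, ?_, ?_, ?_⟩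
    · simp only [bil_add_left, bil_add_right, bil_smul_left, bil_smul_right, hBq, bil_comm hB s q]
      field_simp
      ring
    · simp [bil_add_right, bil_smul_right, hs1, hpq]
    · simpa [bil_add_right, bil_smul_right, hBq] using hs2
  refine ⟨p, q, r, fun h0 => ?_, hpp, hAq, by assumption, hBq, hrr, hpq, hpr⟩
  have := det_gram B ![p, q, r]
  rw [h0, gram_eq hB, hBq, hrr, hpq, hpr, det_fin_three] at this
  simp [hBp, hqr] at this

end Triangles

/-! ### Quadratic forms and Hessian matrices -/

section Hessian

variable {K : Type*} [Field K]

/-- The Hessian matrix, at the origin, of a polynomial. -/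
def hess : MvPolynomial (Fin 3) K →ₗ[K] Matrix (Fin 3) (Fin 3) K where
  toFun f := of fun i j =>
    MvPolynomial.constantCoeff (MvPolynomial.pderiv j (MvPolynomial.pderiv i f))
  map_add' f g := by ext; simp
  map_smul' c f := by ext; simp

lemma pderiv_pderiv_comm (i j : Fin 3) (f : MvPolynomial (Fin 3) K) :
    MvPolynomial.pderiv j (MvPolynomial.pderiv i f) =
      MvPolynomial.pderiv i (MvPolynomial.pderiv j f) := by
  have h : ⁅MvPolynomial.pderiv (R := K) j, MvPolynomial.pderiv (R := K) i⁆ = 0 := by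
    refine MvPolynomial.derivation_ext fun k => ?_
    simp [Derivation.commutator_apply, MvPolynomial.pderiv_X, Pi.single_apply, apply_ite]
  have := DFunLike.congr_fun h f
  rw [Derivation.commutator_apply] at this
  exact sub_eq_zero.mp this

lemma hess_transpose (f : MvPolynomial (Fin 3) K) : (hess f)ᵀ = hess f := by
  ext i j
  simp only [hess, LinearMap.coe_mk, AddHom.coe_mk, transpose_apply, of_apply,
    pderiv_pderiv_comm i j]

/-- Euler's identity for the partial derivatives, which are linear forms. -/
lemma pderiv_eq {f : MvPolynomial (Fin 3) K} (hf : f.IsHomogeneous 2) (i : Fin 3) :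
    MvPolynomial.pderiv i f = ∑ j, MvPolynomial.C (hess f i j) * MvPolynomial.X j := by
  have h1 : (MvPolynomial.pderiv i f).IsHomogeneous 1 := hf.pderiv
  have h2 := h1.sum_X_mul_pderiv
  rw [one_smul] at h2
  rw [← h2]
  refine Finset.sum_congr rfl fun j _ => ?_
  have h3 : (MvPolynomial.pderiv j (MvPolynomial.pderiv i f)).IsHomogeneous 0 := h1.pderiv
  have h4 := MvPolynomial.totalDegree_eq_zero_iff_eq_C.mp (Nat.le_zero.mp h3.totalDegree_le)
  rw [h4, mul_comm]
  simp [hess, MvPolynomial.constantCoeff_eq]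

lemma two_smul_eq {f : MvPolynomial (Fin 3) K} (hf : f.IsHomogeneous 2) :
    2 * f = ∑ i, MvPolynomial.X i * ∑ j, MvPolynomial.C (hess f i j) * MvPolynomial.X j := by
  have := hf.sum_X_mul_pderiv
  simp_rw [pderiv_eq hf] at this
  rw [this, nsmul_eq_mul]
  norm_num

/-- Quadratic forms correspond to symmetric matrices by taking the Hessian. -/
def hessEquiv (h2 : (2 : K) ≠ 0) : MvPolynomial.homogeneousSubmodule (Fin 3) K 2 ≃
    {A : Matrix (Fin 3) (Fin 3) K // Aᵀ = A} :=
  Equiv.ofBijective (fun f => ⟨hess f.1, hess_transpose f.1⟩) <| by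
    constructor
    · intro f g h
      have h' : hess f.1 = hess g.1 := congrArg Subtype.val h
      have hf := two_smul_eq (MvPolynomial.mem_homogeneousSubmodule _ _ |>.mp f.2)
      have hg := two_smul_eq (MvPolynomial.mem_homogeneousSubmodule _ _ |>.mp g.2)
      rw [h', ← hg] at hf
      have h2' : (2 : MvPolynomial (Fin 3) K) ≠ 0 := by
        rw [← map_ofNat MvPolynomial.C]
        simpa using h2
      exact Subtype.ext (mul_left_cancel₀ h2' hf)
    · rintro ⟨A, hA⟩
      -- Division by 2 compensates for the Hessian of xᵀAx being 2A.
      have hhom : (∑ i, ∑ j, MvPolynomial.C (A i j / 2) *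
          (MvPolynomial.X i * MvPolynomial.X j) : MvPolynomial (Fin 3) K).IsHomogeneous 2 := by
        refine MvPolynomial.IsHomogeneous.sum _ _ _ fun i _ =>
          MvPolynomial.IsHomogeneous.sum _ _ _ fun j _ => ?_
        simpa using (MvPolynomial.isHomogeneous_C (Fin 3) (A i j / 2)).mul
          ((MvPolynomial.isHomogeneous_X K i).mul (MvPolynomial.isHomogeneous_X K j))
      refine ⟨⟨_, (MvPolynomial.mem_homogeneousSubmodule _ _).mpr hhom⟩, Subtype.ext ?_⟩
      have h10 : A 1 0 = A 0 1 := congrFun (congrFun hA 0) 1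
      have h20 : A 2 0 = A 0 2 := congrFun (congrFun hA 0) 2
      have h21 : A 2 1 = A 1 2 := congrFun (congrFun hA 1) 2
      have : NeZero (2 : K) := ⟨h2⟩
      ext i j
      simp only [hess, LinearMap.coe_mk, AddHom.coe_mk, map_sum, Derivation.leibniz,
        MvPolynomial.pderiv_C, MvPolynomial.pderiv_X, map_add, smul_eq_mul, map_mul,
        MvPolynomial.constantCoeff_C, MvPolynomial.constantCoeff_X]
      fin_cases i <;> fin_cases j <;>
        simp [Fin.sum_univ_three, Pi.single_apply, h10, h20, h21, mul_add]

/-- The Hessian matrix of a conic over the algebraic closure. -/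
def Conic.matrix (C : Conic K) : Matrix (Fin 3) (Fin 3) (AlgebraicClosure K) :=
  (hess C.form).map (algebraMap K (AlgebraicClosure K))

lemma Conic.matrix_transpose (C : Conic K) : C.matrixᵀ = C.matrix := by
  rw [Conic.matrix, ← transpose_map, hess_transpose]

lemma Conic.form_isHomogeneous (C : Conic K) : C.form.IsHomogeneous 2 :=
  (MvPolynomial.mem_homogeneousSubmodule _ _).mp C.rep.2

lemma gradient_eq (C : Conic K) (P : Point K) : gradient C P = C.matrix *ᵥ P.rep := by
  ext i
  rw [gradient, pderiv_eq C.form_isHomogeneous]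
  simp [Conic.matrix, mulVec, dotProduct]

lemma two_ne_zero_algebraicClosure (h2 : (2 : K) ≠ 0) : (2 : AlgebraicClosure K) ≠ 0 := by
  rw [← map_ofNat (algebraMap K (AlgebraicClosure K))]
  exact (map_ne_zero _).mpr h2

lemma onConic_iff (h2 : (2 : K) ≠ 0) (P : Point K) (C : Conic K) :
    OnConic P C ↔ bil C.matrix P.rep P.rep = 0 := by
  have h := congrArg (MvPolynomial.aeval P.rep) (two_smul_eq C.form_isHomogeneous)
  have h2' := two_ne_zero_algebraicClosure h2
  have hb : bil C.matrix P.rep P.rep = 2 * MvPolynomial.aeval P.rep C.form := by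
    rw [map_mul, map_ofNat] at h
    rw [h]
    simp [bil, Conic.matrix, mulVec, dotProduct]
  rw [OnConic, hb]
  simp [h2']

lemma incident_iff (P : Point K) (ξ : Line K) : Incident P ξ ↔ P.rep ⬝ᵥ ξ.rep = 0 := by
  have := Projectivization.orthogonal_mk P.rep_nonzero ξ.rep_nonzero
  rwa [Projectivization.mk_rep, Projectivization.mk_rep] at this

lemma incident_mk {x y : Fin 3 → AlgebraicClosure K} (hx : x ≠ 0) (hy : y ≠ 0) :
    Incident (K := K) (.mk _ x hx) (.mk _ y hy) ↔ x ⬝ᵥ y = 0 := Iff.rfl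

lemma exists_mk_rep {x : Fin 3 → AlgebraicClosure K} (hx : x ≠ 0) :
    ∃ c : AlgebraicClosure K, c ≠ 0 ∧ (Projectivization.mk (AlgebraicClosure K) x hx).rep = c • x := by
  obtain ⟨a, ha⟩ := Projectivization.exists_smul_eq_mk_rep (AlgebraicClosure K) x hx
  exact ⟨a, a.ne_zero, ha.symm⟩

lemma onConic_mk (h2 : (2 : K) ≠ 0) {x : Fin 3 → AlgebraicClosure K} (hx : x ≠ 0) (C : Conic K) :
    OnConic (.mk _ x hx) C ↔ bil C.matrix x x = 0 := by
  obtain ⟨c, hc, h⟩ := exists_mk_rep (K := K) hx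
  rw [onConic_iff h2, h, bil_smul_left, bil_smul_right]
  simp [hc]

lemma isTangentAt_mk (h2 : (2 : K) ≠ 0) {x y : Fin 3 → AlgebraicClosure K} (hx : x ≠ 0)
    (hy : y ≠ 0) (C : Conic K) :
    IsTangentAt C (.mk _ x hx) (.mk _ y hy) ↔
      bil C.matrix x x = 0 ∧ ∃ c : AlgebraicClosure K, c ≠ 0 ∧ C.matrix *ᵥ x = c • y := by
  obtain ⟨a, ha, hxa⟩ := exists_mk_rep (K := K) hx
  obtain ⟨b, hb, hyb⟩ := exists_mk_rep (K := K) hy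
  rw [IsTangentAt, onConic_mk h2, gradient_eq, hxa, hyb, mulVec_smul]
  refine and_congr_right fun _ => ⟨fun ⟨c, hc, h⟩ => ⟨a⁻¹ * c * b, by positivity, ?_⟩,
    fun ⟨c, hc, h⟩ => ⟨a * c * b⁻¹, by positivity, ?_⟩⟩
  · rw [mul_assoc, mul_smul, mul_smul, ← h, smul_smul, inv_mul_cancel₀ ha, one_smul]
  · rw [h, smul_smul, smul_smul, mul_assoc, mul_assoc, inv_mul_cancel₀ hb, mul_one]

lemma linearIndependent_rep {P Q : Point K} (h : P ≠ Q) :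
    LinearIndependent (AlgebraicClosure K) ![P.rep, Q.rep] := by
  have := Projectivization.independent_iff.mp ((Projectivization.independent_pair_iff_ne P Q).mpr h)
  have e : Projectivization.rep ∘ ![P, Q] = ![P.rep, Q.rep] := by
    ext i
    fin_cases i <;> rfl
  rwa [e] at this

/-! ### Smoothness and transversality -/

lemma isSmooth_iff (h2 : (2 : K) ≠ 0) (C : Conic K) : IsSmooth C ↔ C.matrix.det ≠ 0 := by
  constructor
  · intro h hd
    obtain ⟨x, hx, h0⟩ := exists_mulVec_eq_zero_iff.mpr hd
    obtain ⟨c, hc, hxc⟩ := exists_mk_rep (K := K) hx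
    refine h (.mk _ x hx) ?_ ?_
    · rw [onConic_mk h2, bil, h0, dotProduct_zero]
    · rw [gradient_eq, hxc, mulVec_smul, h0, smul_zero]
  · intro h P _ h0
    rw [gradient_eq] at h0
    exact P.rep_nonzero (eq_zero_of_mulVec_eq_zero h h0)

lemma IsTransversal.linearIndependent (h2 : (2 : K) ≠ 0) {A B : Conic K} (h : IsTransversal A B)
    (x : Fin 3 → AlgebraicClosure K) (hx : x ≠ 0) (hA : bil A.matrix x x = 0)
    (hB : bil B.matrix x x = 0) :
    LinearIndependent (AlgebraicClosure K) ![A.matrix *ᵥ x, B.matrix *ᵥ x] := by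
  have := h (.mk _ x hx) ((onConic_mk h2 hx A).mpr hA) ((onConic_mk h2 hx B).mpr hB)
  obtain ⟨c, hc, hxc⟩ := exists_mk_rep (K := K) hx
  rw [gradient_eq, gradient_eq, hxc, mulVec_smul, mulVec_smul, LinearIndependent.pair_iff] at this
  rw [LinearIndependent.pair_iff]
  intro s t hst
  refine this s t ?_
  rw [smul_comm s, smul_comm t, ← smul_add, hst, smul_zero]

/-- Gradients AP and BP that are dependent at a common point mean BP = rAP, which by the two
tangency lemmas is possible exactly when the characteristic polynomial has a repeated root r. -/
lemma isTransversal_iff (h2 : (2 : K) ≠ 0) (h3 : (3 : K) ≠ 0) {A B : Conic K}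
    (hA : A.matrix.det ≠ 0) :
    IsTransversal A B ↔ cubicDiscr (charData (A.matrix⁻¹ * B.matrix)) ≠ 0 := by
  have h2' := two_ne_zero_algebraicClosure h2
  have h3' : (3 : AlgebraicClosure K) ≠ 0 := by
    rw [← map_ofNat (algebraMap K (AlgebraicClosure K))]
    exact (map_ne_zero _).mpr h3
  rw [Ne, cubicDiscr_eq_zero_iff h2' h3']
  constructor
  · rintro h ⟨r, s, hrs⟩
    obtain ⟨q, hq, hqq, hr⟩ :=
      exists_tangent_of_charData A.matrix_transpose B.matrix_transpose hA hrs
    have hli := h.linearIndependent h2 q hq hqq (by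
      rw [bil, hr, dotProduct_smul]
      exact smul_eq_zero_of_right _ hqq)
    rw [LinearIndependent.pair_iff] at hli
    have := (hli r (-1) (by rw [hr]; simp)).2
    simp at this
  · intro h P hPA hPB
    by_contra hli
    apply h
    rw [onConic_iff h2] at hPA hPB
    rw [gradient_eq, gradient_eq] at hli
    have hne : A.matrix *ᵥ P.rep ≠ 0 := fun h0 => P.rep_nonzero (eq_zero_of_mulVec_eq_zero hA h0)
    rw [LinearIndependent.pair_iff' hne] at hli
    push Not at hli
    obtain ⟨r, hr⟩ := hli
    obtain ⟨s, hs⟩ := charData_of_tangent A.matrix_transpose B.matrix_transpose hA P.rep_nonzero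
      hPA hr.symm
    exact ⟨r, s, hs⟩

end Hessian

/-! ### The Poncelet triangle condition -/

section Triangle

variable {K : Type*} [Field K]

lemma bil_rep_eq_zero_iff {C : Conic K} {Q : Point K} {ξ : Line K} (h : IsTangentAt C Q ξ)
    (P : Point K) : bil C.matrix P.rep Q.rep = 0 ↔ Incident P ξ := by
  obtain ⟨-, c, hc, hg⟩ := h
  rw [gradient_eq] at hg
  rw [incident_iff, bil, hg, dotProduct_smul, smul_eq_zero_iff_right hc]

lemma IsTangentAt.eq {C : Conic K} {Q : Point K} {ξ η : Line K} (h : IsTangentAt C Q ξ)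
    (h' : IsTangentAt C Q η) : ξ = η := by
  obtain ⟨-, c, hc, hg⟩ := h
  obtain ⟨-, d, hd, hg'⟩ := h'
  rw [← ξ.mk_rep, ← η.mk_rep, Projectivization.mk_eq_mk_iff']
  refine ⟨c⁻¹ * d, ?_⟩
  rw [mul_smul, ← hg', hg, smul_smul, inv_mul_cancel₀ hc, one_smul]

lemma eq_of_bil_eq_zero (h2 : (2 : K) ≠ 0) {C : Conic K} (hd : C.matrix.det ≠ 0) {P Q : Point K}
    (hP : OnConic P C) (hQ : OnConic Q C) (h : bil C.matrix P.rep Q.rep = 0) : P = Q := by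
  by_contra hne
  exact bil_ne_zero_of_isotropic C.matrix_transpose hd (linearIndependent_rep hne)
    ((onConic_iff h2 _ _).mp hP) ((onConic_iff h2 _ _).mp hQ) h

/-- A closed triangle with two coinciding vertices. -/
lemma sq_eq_of_coincident (h2 : (2 : K) ≠ 0) {A B : Conic K} (hA : A.matrix.det ≠ 0)
    (hB : B.matrix.det ≠ 0) (htr : IsTransversal A B) {e₀ e₁ e₂ : Point K × Line K}
    (h01 : PonceletStep A B e₀ e₁) (h12 : PonceletStep A B e₁ e₂) (h20 : PonceletStep A B e₂ e₀)
    (heq : e₁.1 = e₀.1) :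
    (charData (A.matrix⁻¹ * B.matrix)).2.1 ^ 2 = 4 * (charData (A.matrix⁻¹ * B.matrix)).2.2 *
      (charData (A.matrix⁻¹ * B.matrix)).1 := by
  obtain ⟨⟨hP0, ⟨Q0, hQ0⟩, hI0⟩, ⟨hP1, ⟨Q1, hQ1⟩, hI1⟩, hI10, hT01, hL01⟩ := h01
  obtain ⟨-, ⟨hP2, ⟨Q2, hQ2⟩, hI2⟩, hI21, hT12, hL12⟩ := h12
  obtain ⟨-, -, hI02, hT20, hL20⟩ := h20
  obtain ⟨-, c, hc, hg⟩ := hT01.mp heq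
  obtain ⟨-, d, hd, hg0⟩ := id hQ0
  have b0 := (bil_rep_eq_zero_iff hQ0 e₀.1).mpr hI0
  have b1 := (bil_rep_eq_zero_iff hQ1 e₁.1).mpr hI1
  have b2 := (bil_rep_eq_zero_iff hQ2 e₀.1).mpr hI02
  rw [heq] at b1 hL01
  -- Otherwise the first line would touch both conics at this vertex, against transversality.
  have hnB : ¬ OnConic e₀.1 B := by
    intro hPB
    obtain rfl := eq_of_bil_eq_zero h2 hB hPB hQ0.1 b0
    have hli := htr e₀.1 hP0 hPB
    rw [hg, hg0, LinearIndependent.pair_iff] at hli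
    exact hd (hli d (-c) (by rw [smul_smul, smul_smul, ← add_smul]; ring_nf; simp)).1
  have hQ01 : Q0 ≠ Q1 := by
    rintro rfl
    exact hnB (hL01.mp (hQ1.eq hQ0))
  have hQ02 : Q0 ≠ Q2 := by
    rintro rfl
    exact hnB (hL20.mp (hQ0.eq hQ2))
  have z0 := (onConic_iff h2 _ _).mp hQ0.1
  have z1 := (onConic_iff h2 _ _).mp hQ1.1
  have z2 := (onConic_iff h2 _ _).mp hQ2.1
  -- All three lines pass through the repeated vertex, but only two tangents to B do, and the first
  -- line differs from the other two.
  have hQ12 : Q1 = Q2 := by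
    by_contra hne
    have hdet := det_ne_zero_of_isotropic (two_ne_zero_algebraicClosure h2) B.matrix_transpose hB
      (linearIndependent_rep hQ01) (linearIndependent_rep hne) (linearIndependent_rep hQ02) z0 z1 z2
    rw [bil_comm B.matrix_transpose] at b0 b1 b2
    exact e₀.1.rep_nonzero (eq_zero_of_bil hB hdet b0 b1 b2)
  subst hQ12
  -- The second and third lines coincide, so the remaining vertex lies on B. The triple p = repeated
  -- vertex, q = remaining vertex, r = Q0 is now the degenerate configuration, with pr tangent to A.
  have hP2B : OnConic e₂.1 B := hL12.mp (hQ2.eq hQ1)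
  obtain rfl : e₂.1 = Q1 :=
    eq_of_bil_eq_zero h2 hB hP2B hQ1.1 ((bil_rep_eq_zero_iff hQ1 e₂.1).mpr hI21)
  have hP02 : e₀.1 ≠ e₂.1 := fun h => hnB (h ▸ hP2B)
  have y0 := (onConic_iff h2 _ _).mp hP0
  have y2 := (onConic_iff h2 _ _).mp hP2
  have hnB' : bil B.matrix e₀.1.rep e₀.1.rep ≠ 0 := fun h => hnB ((onConic_iff h2 _ _).mpr h)
  have hqr := bil_ne_zero_of_isotropic B.matrix_transpose hB (linearIndependent_rep hQ01.symm) z1 z0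
  refine (sq_eq_iff_of_degenerate (two_ne_zero_algebraicClosure h2) A.matrix_transpose
    B.matrix_transpose hA hB (p := e₀.1.rep) (q := e₂.1.rep) (r := Q0.rep) ?_ y0 y2
    (bil_ne_zero_of_isotropic A.matrix_transpose hA (linearIndependent_rep hP02) y0 y2) z1 z0 b1
    b0).mpr ?_
  · intro h0
    have := det_gram B.matrix ![e₀.1.rep, e₂.1.rep, Q0.rep]
    rw [h0, gram_eq B.matrix_transpose, z1, z0, b1, b0, det_fin_three] at this
    simp [hnB', hqr] at this
  · rw [bil_comm A.matrix_transpose, bil, ← gradient_eq, hg, dotProduct_smul,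
      (incident_iff Q0 e₀.2).mp ((bil_rep_eq_zero_iff hQ0 Q0).mp z0), smul_zero]

lemma sq_eq_of_ponceletTriangle (h2 : (2 : K) ≠ 0) {A B : Conic K} (hA : A.matrix.det ≠ 0)
    (hB : B.matrix.det ≠ 0) (htr : IsTransversal A B) (h : PonceletTriangle A B) :
    (charData (A.matrix⁻¹ * B.matrix)).2.1 ^ 2 = 4 * (charData (A.matrix⁻¹ * B.matrix)).2.2 *
      (charData (A.matrix⁻¹ * B.matrix)).1 := by
  obtain ⟨e₀, e₁, e₂, h01, h12, h20⟩ := h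
  by_cases h1 : e₁.1 = e₀.1
  · exact sq_eq_of_coincident h2 hA hB htr h01 h12 h20 h1
  by_cases h2' : e₂.1 = e₁.1
  · exact sq_eq_of_coincident h2 hA hB htr h12 h20 h01 h2'
  by_cases h3 : e₀.1 = e₂.1
  · exact sq_eq_of_coincident h2 hA hB htr h20 h01 h12 h3
  obtain ⟨⟨hP0, ⟨Q0, hQ0⟩, hI0⟩, ⟨hP1, ⟨Q1, hQ1⟩, hI1⟩, hI10, -, -⟩ := h01
  obtain ⟨-, ⟨hP2, ⟨Q2, hQ2⟩, hI2⟩, hI21, -, -⟩ := h12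
  obtain ⟨-, -, hI02, -, -⟩ := h20
  have y0 := (onConic_iff h2 _ _).mp hP0
  have y1 := (onConic_iff h2 _ _).mp hP1
  have y2 := (onConic_iff h2 _ _).mp hP2
  have hdet := det_ne_zero_of_isotropic (two_ne_zero_algebraicClosure h2) A.matrix_transpose hA
    (linearIndependent_rep (Ne.symm h1)) (linearIndependent_rep (Ne.symm h2'))
    (linearIndependent_rep h3) y0 y1 y2
  refine sq_eq_of_triangle A.matrix_transpose B.matrix_transpose hA hdet y0 y1 y2 ?_ ?_ ?_
  · exact minor_eq_zero_of_tangent B.matrix_transpose hB hdet Q0.rep_nonzero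
      ((onConic_iff h2 _ _).mp hQ0.1) ((bil_rep_eq_zero_iff hQ0 _).mpr hI0)
      ((bil_rep_eq_zero_iff hQ0 _).mpr hI10)
  · exact minor_eq_zero_of_tangent B.matrix_transpose hB (by rwa [det_rotate]) Q1.rep_nonzero
      ((onConic_iff h2 _ _).mp hQ1.1) ((bil_rep_eq_zero_iff hQ1 _).mpr hI1)
      ((bil_rep_eq_zero_iff hQ1 _).mpr hI21)
  · have := minor_eq_zero_of_tangent B.matrix_transpose hB
      (by rwa [det_rotate, det_rotate]) Q2.rep_nonzero
      ((onConic_iff h2 _ _).mp hQ2.1) ((bil_rep_eq_zero_iff hQ2 _).mpr hI2)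
      ((bil_rep_eq_zero_iff hQ2 _).mpr hI02)
    rw [bil_comm B.matrix_transpose e₂.1.rep e₀.1.rep] at this
    linear_combination this

/-- The closed orbit is (p, pr), (p, pq), (q, pq): the line pr touches A at p, so the point stays
and the tangent changes; the next point q lies on B, so the line pq stays; the last step leads back
to p and pr. -/
lemma ponceletTriangle_of_sq_eq (h2 : (2 : K) ≠ 0) {A B : Conic K} (hA : A.matrix.det ≠ 0)
    (hB : B.matrix.det ≠ 0) (htr : IsTransversal A B)
    (h : (charData (A.matrix⁻¹ * B.matrix)).2.1 ^ 2 =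
      4 * (charData (A.matrix⁻¹ * B.matrix)).2.2 * (charData (A.matrix⁻¹ * B.matrix)).1) :
    PonceletTriangle A B := by
  have h2' := two_ne_zero_algebraicClosure h2
  obtain ⟨p, q, r, hdet, hpp, hqq, hpq, hqq', hrr', hpq', hpr'⟩ :=
    exists_degenerate_configuration h2' A.matrix_transpose B.matrix_transpose hA hB
      (htr.linearIndependent h2)
  have hpr := (sq_eq_iff_of_degenerate h2' A.matrix_transpose B.matrix_transpose hA hB hdet hpp hqq
    hpq hqq' hrr' hpq' hpr').mp h
  have hgB : (gram B.matrix ![p, q, r]).det ≠ 0 := by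
    rw [det_gram]; exact mul_ne_zero (pow_ne_zero 2 hdet) hB
  rw [gram_eq B.matrix_transpose, hqq', hrr', hpq', hpr', det_fin_three] at hgB
  simp at hgB
  obtain ⟨hpp', hqr'⟩ := hgB
  have b0 : ∀ (C : Conic K) x, bil C.matrix x 0 = 0 := fun C x => by simp [bil]
  have hp0 : p ≠ 0 := by rintro rfl; exact hpp' (b0 B _)
  have hq0 : q ≠ 0 := by rintro rfl; exact hpq (b0 A _)
  have hr0 : r ≠ 0 := by rintro rfl; exact hqr' (b0 B _)
  have hBq : B.matrix *ᵥ q ≠ 0 := fun h0 => hq0 (eq_zero_of_mulVec_eq_zero hB h0)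
  have hBr : B.matrix *ᵥ r ≠ 0 := fun h0 => hr0 (eq_zero_of_mulVec_eq_zero hB h0)
  -- Ap and Br both vanish on p and r, so they are proportional, with the factor read off at q.
  have hAp : A.matrix *ᵥ p = (bil A.matrix p q / bil B.matrix q r) • B.matrix *ᵥ r := by
    refine sub_eq_zero.mp (eq_zero_of_dotProduct hdet fun i => ?_)
    rw [dotProduct_sub, dotProduct_smul]
    change bil A.matrix _ _ - _ * bil B.matrix _ _ = 0
    fin_cases i
    · simp [hpp, hpr']
    · simp [bil_comm A.matrix_transpose q p, hqr']
    · simp [bil_comm A.matrix_transpose r p, hpr, hrr']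
  have htan : IsTangentAt A (.mk _ p hp0) (.mk _ _ hBr) :=
    (isTangentAt_mk h2 hp0 hBr A).mpr ⟨hpp, _, div_ne_zero hpq hqr', hAp⟩
  have htq : IsTangentAt B (.mk _ q hq0) (.mk _ _ hBq) :=
    (isTangentAt_mk h2 hq0 hBq B).mpr ⟨hqq', 1, one_ne_zero, (one_smul _ _).symm⟩
  have htr : IsTangentAt B (.mk _ r hr0) (.mk _ _ hBr) :=
    (isTangentAt_mk h2 hr0 hBr B).mpr ⟨hrr', 1, one_ne_zero, (one_smul _ _).symm⟩
  have hnP : ¬ OnConic (.mk _ p hp0) B := by rwa [onConic_mk h2]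
  have hne : (Projectivization.mk _ _ hBr : Line K) ≠ .mk _ _ hBq := by
    rw [Ne, Projectivization.mk_eq_mk_iff']
    rintro ⟨a, ha⟩
    have := congrArg (q ⬝ᵥ ·) ha
    simp only [dotProduct_smul] at this
    change a * bil B.matrix q q = bil B.matrix q r at this
    rw [hqq', mul_zero] at this
    exact hqr' this.symm
  have hPQ : (Projectivization.mk _ p hp0 : Point K) ≠ .mk _ q hq0 := by
    intro h0
    rw [h0, onConic_mk h2] at hnP
    exact hnP hqq'
  have hnt1 : ¬ IsTangentAt A (.mk _ p hp0) (.mk _ _ hBq) := by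
    rw [isTangentAt_mk h2]
    rintro ⟨-, c, -, hc⟩
    have := congrArg (q ⬝ᵥ ·) hc
    simp only [dotProduct_smul] at this
    change bil A.matrix q p = c * bil B.matrix q q at this
    rw [hqq', mul_zero, bil_comm A.matrix_transpose] at this
    exact hpq this
  have hnt2 : ¬ IsTangentAt A (.mk _ q hq0) (.mk _ _ hBq) := by
    rw [isTangentAt_mk h2]
    rintro ⟨-, c, -, hc⟩
    have := congrArg (p ⬝ᵥ ·) hc
    simp only [dotProduct_smul] at this
    change bil A.matrix p q = c * bil B.matrix p q at this
    rw [hpq', mul_zero] at this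
    exact hpq this
  have hPA := (onConic_mk h2 hp0 A).mpr hpp
  have hQA := (onConic_mk h2 hq0 A).mpr hqq
  have hQB := (onConic_mk h2 hq0 B).mpr hqq'
  have i0 : Incident (K := K) (.mk _ p hp0) (.mk _ _ hBr) := (incident_mk hp0 hBr).mpr hpr'
  have i1 : Incident (K := K) (.mk _ p hp0) (.mk _ _ hBq) := (incident_mk hp0 hBq).mpr hpq'
  have i2 : Incident (K := K) (.mk _ q hq0) (.mk _ _ hBq) := (incident_mk hq0 hBq).mpr hqq'
  have m0 : ((.mk _ p hp0, .mk _ _ hBr) : Point K × Line K) ∈ incidenceCurve A B :=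
    ⟨hPA, ⟨_, htr⟩, i0⟩
  have m1 : ((.mk _ p hp0, .mk _ _ hBq) : Point K × Line K) ∈ incidenceCurve A B :=
    ⟨hPA, ⟨_, htq⟩, i1⟩
  have m2 : ((.mk _ q hq0, .mk _ _ hBq) : Point K × Line K) ∈ incidenceCurve A B :=
    ⟨hQA, ⟨_, htq⟩, i2⟩
  exact ⟨_, _, _, ⟨m0, m1, i0, iff_of_true rfl htan, iff_of_false hne.symm hnP⟩,
    ⟨m1, m2, i2, iff_of_false hPQ.symm hnt1, iff_of_true rfl hQB⟩,
    ⟨m2, m0, i1, iff_of_false hPQ hnt2, iff_of_false hne hnP⟩⟩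

end Triangle

/-! ### Counting pairs of conics -/

section CountPairs

variable {K : Type*} [Field K]

/-- The coefficients of `det (t A + B) / det A`, where `A` and `B` are the Hessian matrices of two
conics. -/
def conicData (A B : Conic K) : K × K × K :=
  charData ((hess A.form)⁻¹ * hess B.form)

lemma Conic.det_matrix (C : Conic K) :
    C.matrix.det = algebraMap K (AlgebraicClosure K) (hess C.form).det := by
  rw [Conic.matrix, RingHom.map_det]; rfl

lemma Conic.det_matrix_ne_zero_iff (C : Conic K) : C.matrix.det ≠ 0 ↔ (hess C.form).det ≠ 0 := by
  rw [C.det_matrix, map_ne_zero]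

lemma charData_matrix {A : Conic K} (B : Conic K) (hA : (hess A.form).det ≠ 0) :
    charData (A.matrix⁻¹ * B.matrix) =
      (algebraMap K (AlgebraicClosure K) (conicData A B).1,
        algebraMap K (AlgebraicClosure K) (conicData A B).2.1,
        algebraMap K (AlgebraicClosure K) (conicData A B).2.2) := by
  rw [conicData, ← charData_map]
  congr 1
  have hu : IsUnit (hess A.form).det := isUnit_iff_ne_zero.mpr hA
  have hu' : IsUnit A.matrix.det := isUnit_iff_ne_zero.mpr (A.det_matrix_ne_zero_iff.mpr hA)
  have h : A.matrix * (((hess A.form)⁻¹ * hess B.form).map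
      (algebraMap K (AlgebraicClosure K))) = B.matrix := by
    rw [Conic.matrix, ← Matrix.map_mul, mul_nonsing_inv_cancel_left _ _ hu]; rfl
  rw [← h, nonsing_inv_mul_cancel_left _ _ hu']

lemma mem_Psi_iff (h2 : (2 : K) ≠ 0) (h3 : (3 : K) ≠ 0) (p : Conic K × Conic K) :
    p ∈ Psi K ↔ (hess p.1.form).det ≠ 0 ∧
      ((conicData p.1 p.2).2.2 ≠ 0 ∧ cubicDiscr (conicData p.1 p.2) ≠ 0) := by
  simp only [Psi, Set.mem_ofPred_eq, isSmooth_iff h2, Conic.det_matrix_ne_zero_iff]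
  refine and_congr_right fun hA => and_congr ?_ ?_
  · rw [← (pencil_eq (hess p.2.form) hA).2.2]
    simp [conicData, hA]
  · rw [isTransversal_iff h2 h3 (p.1.det_matrix_ne_zero_iff.mpr hA), charData_matrix _ hA,
      cubicDiscr_map, map_ne_zero]

lemma mem_Gamma3_iff (h2 : (2 : K) ≠ 0) (h3 : (3 : K) ≠ 0) (p : Conic K × Conic K) :
    p ∈ Gamma3 K ↔ (hess p.1.form).det ≠ 0 ∧
      (((conicData p.1 p.2).2.2 ≠ 0 ∧ cubicDiscr (conicData p.1 p.2) ≠ 0) ∧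
      (conicData p.1 p.2).2.1 ^ 2 = 4 * (conicData p.1 p.2).2.2 * (conicData p.1 p.2).1) := by
  rw [← and_assoc, ← mem_Psi_iff h2 h3]
  simp only [Gamma3, Set.mem_ofPred_eq]
  refine and_congr_right fun hp => ?_
  have hA := (mem_Psi_iff h2 h3 p).mp hp |>.1
  have hAd := p.1.det_matrix_ne_zero_iff.mpr hA
  have hBd := (isSmooth_iff h2 _).mp hp.2.1
  have hiff : PonceletTriangle p.1 p.2 ↔ _ :=
    ⟨sq_eq_of_ponceletTriangle h2 hAd hBd hp.2.2, ponceletTriangle_of_sq_eq h2 hAd hBd hp.2.2⟩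
  rw [hiff, charData_matrix _ hA]
  refine ⟨fun h => (algebraMap K (AlgebraicClosure K)).injective ?_, fun h => ?_⟩
  · simpa only [map_pow, map_mul, map_ofNat] using h
  · simpa only [map_pow, map_mul, map_ofNat] using congrArg (algebraMap K (AlgebraicClosure K)) h

lemma smul_hess_injective (h2 : (2 : K) ≠ 0) {C D : Conic K} {u v : Kˣ}
    (h : (u : K) • hess C.form = (v : K) • hess D.form) : C = D ∧ u = v := by
  have h1 : (u : K) • C.rep = (v : K) • D.rep := by
    refine (hessEquiv h2).injective (Subtype.ext ?_)
    change hess ((u : K) • C.form) = hess ((v : K) • D.form)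
    rw [map_smul, map_smul, h]
  have hCD : C = D := by
    rw [← C.mk_rep, ← D.mk_rep, Projectivization.mk_eq_mk_iff']
    refine ⟨(u : K)⁻¹ * v, ?_⟩
    rw [mul_smul, ← h1, smul_smul, inv_mul_cancel₀ u.ne_zero, one_smul]
  subst hCD
  exact ⟨rfl, Units.ext (smul_left_injective K C.rep_nonzero h1)⟩

lemma exists_smul_hess_eq (h2 : (2 : K) ≠ 0) {A : Matrix (Fin 3) (Fin 3) K} (hA : Aᵀ = A)
    (hd : A.det ≠ 0) : ∃ (C : Conic K) (u : Kˣ), (u : K) • hess C.form = A := by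
  obtain ⟨f, hf⟩ := (hessEquiv h2).surjective ⟨A, hA⟩
  have hfA : hess f.1 = A := congrArg Subtype.val hf
  have hf0 : f ≠ 0 := by
    rintro rfl
    apply hd
    rw [← hfA]
    simp
  obtain ⟨a, ha⟩ := Projectivization.exists_smul_eq_mk_rep K f hf0
  refine ⟨.mk K f hf0, a⁻¹, ?_⟩
  have : Conic.form (Projectivization.mk K f hf0) = (a : K) • f.1 := by
    rw [Conic.form, ← ha]; rfl
  rw [this, map_smul, smul_smul, hfA]
  simp

lemma charData_smul_inv_mul (u v : Kˣ) (A B : Matrix (Fin 3) (Fin 3) K) (hA : A.det ≠ 0) :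
    charData (((u : K) • A)⁻¹ * ((v : K) • B)) =
      (((v / u : Kˣ) : K) * (charData (A⁻¹ * B)).1, ((v / u : Kˣ) : K) ^ 2 * (charData (A⁻¹ * B)).2.1,
        ((v / u : Kˣ) : K) ^ 3 * (charData (A⁻¹ * B)).2.2) := by
  have hu : IsUnit ((u : K) • A).det := by
    rw [det_smul]
    exact isUnit_iff_ne_zero.mpr (mul_ne_zero (pow_ne_zero _ u.ne_zero) hA)
  have h : ((u : K) • A)⁻¹ * ((v : K) • B) = ((v / u : Kˣ) : K) • (A⁻¹ * B) := by
    have : (v : K) • B = ((u : K) • A) * (((v / u : Kˣ) : K) • (A⁻¹ * B)) := by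
      rw [Matrix.smul_mul, Matrix.mul_smul,
        mul_nonsing_inv_cancel_left _ _ (isUnit_iff_ne_zero.mpr hA), smul_smul, ← Units.val_mul,
        mul_div_cancel]
    rw [this, nonsing_inv_mul_cancel_left _ _ hu]
  rw [h]
  simp [charData, trace_smul, adjugate_smul]

/-- Each pair of conics comes from (q − 1)² pairs of matrices. Rescaling A by u and B by v
multiplies (τ, σ, δ) by c, c², c³ with c = v/u, whence the invariance required of R. -/
lemma card_conic_pairs [Fintype K] (h2 : (2 : K) ≠ 0) (hcard : 3 < Fintype.card K)
    {R : K × K × K → Prop} (hR : ∀ x, R x → x.2.2 ≠ 0 ∧ cubicDiscr x ≠ 0)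
    (hR' : ∀ (c : Kˣ) x, R ((c : K) * x.1, (c : K) ^ 2 * x.2.1, (c : K) ^ 3 * x.2.2) ↔ R x) :
    {p : Conic K × Conic K | (hess p.1.form).det ≠ 0 ∧ R (conicData p.1 p.2)}.ncard *
      (Fintype.card K - 1) ^ 2 = Nat.card {x // R x} * Nat.card (GL (Fin 3) K) := by
  classical
  rw [← card_symm_pairs h2 hcard (fun x hx => (hR x hx).2), ← Nat.card_coe_set_eq,
    ← Fintype.card_units, ← Nat.card_eq_fintype_card, sq, ← Nat.card_prod, ← Nat.card_prod]
  refine Nat.card_congr (Equiv.ofBijective (fun y =>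
    ⟨((y.2.1 : K) • hess y.1.1.1.form, (y.2.2 : K) • hess y.1.1.2.form), ?_⟩) ⟨?_, ?_⟩)
  · refine ⟨by rw [transpose_smul, hess_transpose], by rw [transpose_smul, hess_transpose], ?_, ?_⟩
    · rw [det_smul]
      exact mul_ne_zero (pow_ne_zero _ y.2.1.ne_zero) y.1.2.1
    · rw [charData_smul_inv_mul _ _ _ _ y.1.2.1, hR']
      exact y.1.2.2
  · rintro ⟨⟨⟨A, B⟩, h⟩, u, v⟩ ⟨⟨⟨A', B'⟩, h'⟩, u', v'⟩ heq
    have heq' := Prod.ext_iff.mp (congrArg Subtype.val heq)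
    obtain ⟨rfl, rfl⟩ := smul_hess_injective h2 heq'.1
    obtain ⟨rfl, rfl⟩ := smul_hess_injective h2 heq'.2
    rfl
  · rintro ⟨⟨A, B⟩, hA, hB, hd, hAB⟩
    -- R forces δ ≠ 0, so B is nonsingular and does define a conic.
    have hdB : B.det ≠ 0 := by
      rw [← (pencil_eq B hd).2.2]
      exact mul_ne_zero hd (hR _ hAB).1
    obtain ⟨C, u, rfl⟩ := exists_smul_hess_eq h2 hA hd
    obtain ⟨D, v, rfl⟩ := exists_smul_hess_eq h2 hB hdB
    have hC : (hess C.form).det ≠ 0 := by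
      intro h0
      apply hd
      change ((u : K) • hess C.form).det = 0
      rw [det_smul, h0, mul_zero]
    refine ⟨⟨⟨(C, D), hC, ?_⟩, u, v⟩, rfl⟩
    simp only at hAB
    rwa [charData_smul_inv_mul _ _ _ _ hC, hR'] at hAB

end CountPairs

end Poncelet
end

/-! ### Evaluation of the two cardinalities -/

theorem mainTheorem3 (K : Type*) [Field K] [Finite K] (q : ℕ) (hq : Nat.card K = q)
    (hchar : 3 < ringChar K) :
    ((Poncelet.Gamma3 K).ncard : ℚ) =
        ((q : ℚ) ^ 5 - (q : ℚ) ^ 2) * ((q : ℚ) + 1) * (q : ℚ) * ((q : ℚ) - 1) ^ 2 ∧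
      ((Poncelet.Gamma3 K).ncard : ℚ) / ((Poncelet.Psi K).ncard : ℚ) =
        ((q : ℚ) - 1) / ((q : ℚ) ^ 2 - (q : ℚ) + 1) := by
  classical
  have := Fintype.ofFinite K
  have h2 : (2 : K) ≠ 0 := fun h => by
    have := Nat.le_of_dvd two_pos ((ringChar.spec K 2).mp (by exact_mod_cast h))
    omega
  have h3 : (3 : K) ≠ 0 := fun h => by
    have := Nat.le_of_dvd three_pos ((ringChar.spec K 3).mp (by exact_mod_cast h))
    omega
  have hcard : 3 < Fintype.card K :=
    hchar.trans_le (Nat.le_of_dvd Fintype.card_pos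
      ((ringChar.spec K _).mp (FiniteField.cast_card_eq_zero K)))
  rw [Nat.card_eq_fintype_card] at hq
  have hdisc : ∀ (c : Kˣ) (x : K × K × K), Poncelet.cubicDiscr
      ((c : K) * x.1, (c : K) ^ 2 * x.2.1, (c : K) ^ 3 * x.2.2) =
      (c : K) ^ 6 * Poncelet.cubicDiscr x := by
    intro c x; simp only [Poncelet.cubicDiscr]; ring
  have hPsi := Poncelet.card_conic_pairs (K := K) h2 hcard
    (R := fun x => x.2.2 ≠ 0 ∧ Poncelet.cubicDiscr x ≠ 0) (fun _ h => h)
    (fun c x => by rw [hdisc]; simp)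
  have hGamma := Poncelet.card_conic_pairs (K := K) h2 hcard
    (R := fun x => (x.2.2 ≠ 0 ∧ Poncelet.cubicDiscr x ≠ 0) ∧ x.2.1 ^ 2 = 4 * x.2.2 * x.1)
    (fun _ h => h.1) (fun c x => by
      rw [hdisc]
      refine and_congr (by simp) ⟨fun h => ?_, fun h => ?_⟩
      · refine mul_left_cancel₀ (pow_ne_zero 4 c.ne_zero) ?_
        linear_combination h
      · linear_combination (c : K) ^ 4 * h)
  have ePsi : {p : Poncelet.Conic K × Poncelet.Conic K | (Poncelet.hess p.1.form).det ≠ 0 ∧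
      ((Poncelet.conicData p.1 p.2).2.2 ≠ 0 ∧
        Poncelet.cubicDiscr (Poncelet.conicData p.1 p.2) ≠ 0)} = Poncelet.Psi K :=
    Set.ext fun p => (Poncelet.mem_Psi_iff h2 h3 p).symm
  have eGamma : {p : Poncelet.Conic K × Poncelet.Conic K | (Poncelet.hess p.1.form).det ≠ 0 ∧
      (((Poncelet.conicData p.1 p.2).2.2 ≠ 0 ∧
        Poncelet.cubicDiscr (Poncelet.conicData p.1 p.2) ≠ 0) ∧
        (Poncelet.conicData p.1 p.2).2.1 ^ 2 =
          4 * (Poncelet.conicData p.1 p.2).2.2 * (Poncelet.conicData p.1 p.2).1)} =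
      Poncelet.Gamma3 K :=
    Set.ext fun p => (Poncelet.mem_Gamma3_iff h2 h3 p).symm
  rw [ePsi] at hPsi
  rw [eGamma] at hGamma
  rw [Nat.card_eq_fintype_card, Fintype.card_subtype] at hPsi hGamma
  have hnP := Poncelet.card_discr_ne_zero K h2 h3
  rw [Poncelet.card_discr_ne_zero_of_sq_eq K h2 h3] at hGamma
  have hGL : (Nat.card (GL (Fin 3) K) : ℚ) =
      ((q : ℚ) ^ 3 - 1) * ((q : ℚ) ^ 3 - q) * ((q : ℚ) ^ 3 - (q : ℚ) ^ 2) := by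
    have hle : ∀ i ≤ 3, ((q ^ 3 - q ^ i : ℕ) : ℚ) = (q : ℚ) ^ 3 - (q : ℚ) ^ i := fun i hi => by
      rw [Nat.cast_sub (Nat.pow_le_pow_right (by omega) hi), Nat.cast_pow, Nat.cast_pow]
    rw [Matrix.card_GL_field, Fin.prod_univ_three, hq, Nat.cast_mul, Nat.cast_mul,
      hle _ (by simp), hle _ (by simp), hle _ (by simp)]
    simp
  rw [hq] at hPsi hGamma hnP hcard
  generalize Nat.card (GL (Fin 3) K) = g at hPsi hGamma hGL
  generalize Finset.card _ = s at hPsi hnP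
  have hsub : ((q - 1 : ℕ) : ℚ) = (q : ℚ) - 1 := by
    rw [Nat.cast_sub (by omega), Nat.cast_one]
  have hPsi' := congrArg (Nat.cast : ℕ → ℚ) hPsi
  have hGamma' := congrArg (Nat.cast : ℕ → ℚ) hGamma
  have hnP' := congrArg (Nat.cast : ℕ → ℚ) hnP
  simp only [Nat.cast_mul, Nat.cast_pow, Nat.cast_add, hsub, hGL] at hPsi' hGamma' hnP'
  have hq3 : (3 : ℚ) < q := by exact_mod_cast hcard
  have hq1 : (q : ℚ) - 1 ≠ 0 := by linarith
  have hq0 : (q : ℚ) ≠ 0 := by linarith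
  have hq2 : (q : ℚ) ^ 2 - q + 1 ≠ 0 := by nlinarith
  -- The (q − 1)² cubics cancel the (q − 1)² scalars, which leaves the order of GL₃.
  have hG : ((Poncelet.Gamma3 K).ncard : ℚ) =
      ((q : ℚ) ^ 5 - (q : ℚ) ^ 2) * ((q : ℚ) + 1) * (q : ℚ) * ((q : ℚ) - 1) ^ 2 := by
    refine mul_right_cancel₀ (pow_ne_zero 2 hq1) (hGamma'.trans ?_)
    ring
  -- The number of cubics for Ψ is q²(q − 1) − (q − 1)² = (q − 1)(q² − q + 1).
  have hP : ((Poncelet.Psi K).ncard : ℚ) * ((q : ℚ) - 1) =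
      ((Poncelet.Gamma3 K).ncard : ℚ) * ((q : ℚ) ^ 2 - q + 1) := by
    refine mul_right_cancel₀ hq1 ?_
    rw [hG]
    linear_combination hPsi' +
      ((q : ℚ) ^ 3 - 1) * ((q : ℚ) ^ 3 - q) * ((q : ℚ) ^ 3 - (q : ℚ) ^ 2) * hnP'
  refine ⟨hG, ?_⟩
  have hG0 : ((Poncelet.Gamma3 K).ncard : ℚ) ≠ 0 := by
    rw [hG]
    have h5 : (q : ℚ) ^ 5 - (q : ℚ) ^ 2 = (q : ℚ) ^ 2 * (((q : ℚ) - 1) * ((q : ℚ) ^ 2 + q + 1)) := by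
      ring
    rw [h5]
    have h7 : (q : ℚ) + 1 ≠ 0 := by linarith
    have h8 : (q : ℚ) ^ 2 + q + 1 ≠ 0 := by positivity
    positivity
  have hP0 : ((Poncelet.Psi K).ncard : ℚ) ≠ 0 := fun h0 => by
    rw [h0, zero_mul] at hP
    exact mul_ne_zero hG0 hq2 hP.symm
  rw [div_eq_div_iff hP0 hq2]
  linear_combination -hP
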